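/- Let $d\ge 2$ be an integer, let $\mathbb F_d$ be the free group on $a_1,\dots,a_d$, let $\mathbb C[\mathbb F_d]$ be its group algebra with canonical basis $(\delta_x)_{x\in\mathbb F_d}$, and let $\mathcal W=\operatorname{span}\{\delta_{a_i}:1\le i\le d\}\subseteq\mathbb C[\mathbb F_d]$. For $2\le p\le\infty$, a unitary representation $(\pi,H)$ of $\mathbb F_d$ is an $\ell^p$-representation if there is a dense subspace $K\subseteq H$ such that for all $\xi,\eta\in K$ the function $t\mapsto\langle\pi(t)\xi,\eta\rangle$ belongs to $\ell^p(\mathbb F_d)$. Let $C^*_{\ell^p}(\mathbb F_d)$ be the C*-algebra obtained by completing $\mathbb C[\mathbb F_d]$ in the norm $\|x\|=\sup\{\|\pi(x)\|:\pi\text{ is an }\ell^p\text{-representation of }\mathbb F_d\}$, and let $\mathcal W_p\subseteq C^*_{\ell^p}(\mathbb F_d)$ be $\mathcal W$ with the operator space structure inherited from $C^*_{\ell^p}(\mathbb F_d)$. For operator spaces $X,Y$ put $d_{cb}(X,Y)=\inf\{\|\phi\|_{cb}\|\phi^{-1}\|_{cb}:\phi:X\to Y\text{ a linear isomorphism}\}$.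 **Theorem.** Let $2\le p<q\le\infty$ and let $T_{p,q}:\mathcal W_p\to\mathcal W_q$ be the identity map. Then $$\|T_{p,q}\|_{cb}\le 1+d\sqrt{2\bigl(1-(2d-1)^{\frac{p-q}{pq}}\bigr)},\qquad \|T_{p,q}^{-1}\|_{cb}=1,$$ and therefore $$d_{cb}(\mathcal W_p,\mathcal W_q)\le 1+d\sqrt{2\bigl(1-(2d-1)^{\frac{p-q}{pq}}\bigr)},$$ where $\frac{p-q}{pq}$ means $\frac1q-\frac1p$, which is $-\frac1p$ for $q=\infty$. -/

import Mathlib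

open scoped ENNReal

noncomputable section

/-! ### `ℓ^p`-representations of a discrete group -/

section Representations

universe u

variable {Γ : Type u} [Group Γ]

/-- A unitary representation `π` of the discrete group `Γ` on a Hilbert space `H` is an
`ℓ^p`-representation if there is a dense subspace `K ⊆ H` such that all matrix coefficients
`t ↦ ⟨π(t) ξ, η⟩` with `ξ, η ∈ K` belong to `ℓ^p(Γ)`. (Mathlib's inner product is linear in its
second argument.) -/
def IsLpRep (p : ℝ≥0∞) {H : Type u} [NormedAddCommGroup H] [InnerProductSpace ℂ H]
    [CompleteSpace H] (π : Γ →* unitary (H →L[ℂ] H)) : Prop :=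
  ∃ K : Submodule ℂ H, Dense (K : Set H) ∧
    ∀ ξ ∈ K, ∀ η ∈ K, Memℓp (fun t : Γ => inner ℂ η ((π t : H →L[ℂ] H) ξ)) p

/-- The extension of a unitary representation of `Γ` to the group algebra `ℂ[Γ]`. -/
def repExtend {H : Type u} [NormedAddCommGroup H] [InnerProductSpace ℂ H]
    [CompleteSpace H] (π : Γ →* unitary (H →L[ℂ] H)) :
    MonoidAlgebra ℂ Γ →ₐ[ℂ] (H →L[ℂ] H) :=
  MonoidAlgebra.lift ℂ (H →L[ℂ] H) Γ ((unitary (H →L[ℂ] H)).subtype.comp π)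

/-- The set of numbers `‖π(x)‖`, with `π` running over all `ℓ^p`-representations of `Γ`. Hilbert
spaces in the universe of `Γ` suffice: the norm of `π(x)` is attained as a supremum over cyclic
`ℓ^p`-subrepresentations, and these are isomorphic to representations on `ℓ²`-spaces there. -/
def lpRepNorms (p : ℝ≥0∞) (x : MonoidAlgebra ℂ Γ) : Set ℝ :=
  {r | ∃ (H : Type u) (_ : NormedAddCommGroup H) (_ : InnerProductSpace ℂ H)
    (_ : CompleteSpace H) (π : Γ →* unitary (H →L[ℂ] H)), IsLpRep p π ∧ r = ‖repExtend π x‖}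

/-- `‖x‖ = sup {‖π(x)‖ : π is an ℓ^p-representation of Γ}` for `x ∈ ℂ[Γ]`. -/
def groupLpNorm (p : ℝ≥0∞) (x : MonoidAlgebra ℂ Γ) : ℝ := sSup (lpRepNorms p x)

/-- The involution of the group algebra: `x*(g) = conj (x(g⁻¹))`. -/
def groupAlgStar (x : MonoidAlgebra ℂ Γ) : MonoidAlgebra ℂ Γ :=
  .ofCoeff ((x.coeff.mapRange star (star_zero ℂ)).equivMapDomain (Equiv.inv Γ))

lemma groupAlgStar_coeff (x : MonoidAlgebra ℂ Γ) (g : Γ) :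
    (groupAlgStar x).coeff g = star (x.coeff g⁻¹) := by
  simp [groupAlgStar, Finsupp.equivMapDomain_apply]

lemma groupAlgStar_add (x y : MonoidAlgebra ℂ Γ) :
    groupAlgStar (x + y) = groupAlgStar x + groupAlgStar y := by
  ext g; simp [groupAlgStar_coeff]

lemma groupAlgStar_zero : groupAlgStar (0 : MonoidAlgebra ℂ Γ) = 0 := by
  ext g; simp [groupAlgStar_coeff]

lemma groupAlgStar_smul (c : ℂ) (x : MonoidAlgebra ℂ Γ) :
    groupAlgStar (c • x) = star c • groupAlgStar x := by
  ext g; simp [groupAlgStar_coeff]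

lemma groupAlgStar_groupAlgStar (x : MonoidAlgebra ℂ Γ) : groupAlgStar (groupAlgStar x) = x := by
  ext g; simp [groupAlgStar_coeff]

lemma groupAlgStar_single (g : Γ) (c : ℂ) :
    groupAlgStar (.single g c : MonoidAlgebra ℂ Γ) = .single g⁻¹ (star c) := by
  classical
  ext h
  simp only [groupAlgStar_coeff, MonoidAlgebra.coeff_single, Finsupp.single_apply]
  by_cases hg : g = h⁻¹
  · subst hg; simp
  · rw [if_neg hg, if_neg (fun h' => hg (by rw [← h', inv_inv])), star_zero]

lemma groupAlgStar_mul (x y : MonoidAlgebra ℂ Γ) :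
    groupAlgStar (x * y) = groupAlgStar y * groupAlgStar x := by
  induction x using MonoidAlgebra.induction_linear with
  | zero => simp [groupAlgStar_zero]
  | add a b ha hb => simp [add_mul, mul_add, groupAlgStar_add, ha, hb]
  | single g c =>
    induction y using MonoidAlgebra.induction_linear with
    | zero => simp [groupAlgStar_zero]
    | add a b ha hb => simp [add_mul, mul_add, groupAlgStar_add, ha, hb]
    | single h e =>
      simp [groupAlgStar_single, MonoidAlgebra.single_mul_single, mul_comm]

section
variable {H : Type u} [NormedAddCommGroup H] [InnerProductSpace ℂ H] [CompleteSpace H]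

lemma repExtend_single (π : Γ →* unitary (H →L[ℂ] H)) (g : Γ) (c : ℂ) :
    repExtend π (.single g c) = c • (π g : H →L[ℂ] H) := by
  simp [repExtend]

lemma repExtend_star (π : Γ →* unitary (H →L[ℂ] H)) (x : MonoidAlgebra ℂ Γ) :
    repExtend π (groupAlgStar x) = star (repExtend π x) := by
  induction x using MonoidAlgebra.induction_linear with
  | zero => simp [groupAlgStar_zero]
  | add a b ha hb => simp [groupAlgStar_add, ha, hb]
  | single g c =>
    rw [groupAlgStar_single, repExtend_single, repExtend_single, star_smul, map_inv]
    rfl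

lemma norm_repExtend_le (π : Γ →* unitary (H →L[ℂ] H)) (x : MonoidAlgebra ℂ Γ) :
    ‖repExtend π x‖ ≤ x.coeff.sum fun _ c => ‖c‖ := by
  have h : repExtend π x = x.coeff.sum fun g c => c • (π g : H →L[ℂ] H) := by
    simp [repExtend, MonoidAlgebra.lift_apply]
  rw [h]
  refine (norm_sum_le _ _).trans (Finset.sum_le_sum fun g _ => ?_)
  rw [norm_smul]
  have h1 : ‖(π g : H →L[ℂ] H)‖ ≤ 1 := by
    refine ContinuousLinearMap.opNorm_le_bound _ zero_le_one fun v => ?_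
    rw [one_mul]
    exact (Unitary.norm_map (π g) v).le
  exact mul_le_of_le_one_right (norm_nonneg _) h1

end

lemma lpRepNorms_bddAbove (p : ℝ≥0∞) (x : MonoidAlgebra ℂ Γ) : BddAbove (lpRepNorms p x) := by
  refine ⟨x.coeff.sum fun _ c => ‖c‖, ?_⟩
  rintro _ ⟨H, _, _, _, π, -, rfl⟩
  exact norm_repExtend_le π x

lemma groupLpNorm_nonneg (p : ℝ≥0∞) (x : MonoidAlgebra ℂ Γ) : 0 ≤ groupLpNorm p x := by
  refine Real.sSup_nonneg ?_
  rintro _ ⟨H, _, _, _, π, -, rfl⟩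
  exact norm_nonneg _

lemma norm_repExtend_le_groupLpNorm {p : ℝ≥0∞} {H : Type u} [NormedAddCommGroup H]
    [InnerProductSpace ℂ H] [CompleteSpace H] {π : Γ →* unitary (H →L[ℂ] H)}
    (hπ : IsLpRep p π) (x : MonoidAlgebra ℂ Γ) : ‖repExtend π x‖ ≤ groupLpNorm p x :=
  le_csSup (lpRepNorms_bddAbove p x) ⟨H, _, _, _, π, hπ, rfl⟩

lemma groupLpNorm_le {p : ℝ≥0∞} {x : MonoidAlgebra ℂ Γ} {C : ℝ} (hC : 0 ≤ C)
    (h : ∀ (H : Type u) [NormedAddCommGroup H] [InnerProductSpace ℂ H] [CompleteSpace H]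
      (π : Γ →* unitary (H →L[ℂ] H)), IsLpRep p π → ‖repExtend π x‖ ≤ C) :
    groupLpNorm p x ≤ C := by
  refine Real.sSup_le ?_ hC
  rintro _ ⟨H, _, _, _, π, hπ, rfl⟩
  exact h H π hπ

/-! The left regular representation is an `ℓ^p`-representation for every `p`; hence `groupLpNorm` is
a norm and not only a seminorm. -/

/-- Left translation by `g` on `ℓ²(Γ)`: `(λ_g f)(x) = f(g⁻¹ x)`. -/
def regTranslate (g : Γ) (f : lp (fun _ : Γ => ℂ) 2) : lp (fun _ : Γ => ℂ) 2 :=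
  ⟨fun x => f (g⁻¹ * x), memℓp_gen (by
    have h := (lp.memℓp f).summable (by norm_num)
    exact (Equiv.mulLeft g⁻¹).summable_iff.mpr h)⟩

lemma regTranslate_apply (g : Γ) (f : lp (fun _ : Γ => ℂ) 2) (x : Γ) :
    regTranslate g f x = f (g⁻¹ * x) := rfl

/-- Left translation as a surjective isometry. -/
def regIsometry (g : Γ) : lp (fun _ : Γ => ℂ) 2 ≃ₗᵢ[ℂ] lp (fun _ : Γ => ℂ) 2 where
  toFun := regTranslate g
  invFun := regTranslate g⁻¹
  left_inv f := by ext x; simp [regTranslate_apply]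
  right_inv f := by ext x; simp [regTranslate_apply]
  map_add' f h := by ext x; simp [regTranslate_apply]
  map_smul' c f := by ext x; simp [regTranslate_apply]
  norm_map' f := by
    change ‖regTranslate g f‖ = ‖f‖
    rw [lp.norm_eq_tsum_rpow (by norm_num), lp.norm_eq_tsum_rpow (by norm_num)]
    congr 1
    exact (Equiv.mulLeft g⁻¹).tsum_eq (fun x => ‖f x‖ ^ (2 : ℝ≥0∞).toReal)

variable (Γ) in
/-- The left regular representation of `Γ`. -/
def regRep : Γ →* unitary (lp (fun _ : Γ => ℂ) 2 →L[ℂ] lp (fun _ : Γ => ℂ) 2) :=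
  (Unitary.linearIsometryEquiv (𝕜 := ℂ) (H := lp (fun _ : Γ => ℂ) 2)).symm.toMonoidHom.comp
    { toFun := regIsometry
      map_one' := by
        ext f x
        change regTranslate 1 f x = f x
        simp [regTranslate_apply]
      map_mul' := fun g h => by
        ext f x
        change regTranslate (g * h) f x = regTranslate g (regTranslate h f) x
        simp [regTranslate_apply, mul_assoc] }

lemma regRep_apply (g x : Γ) (f : lp (fun _ : Γ => ℂ) 2) :
    (regRep Γ g : lp (fun _ : Γ => ℂ) 2 →L[ℂ] lp (fun _ : Γ => ℂ) 2) f x = f (g⁻¹ * x) := rfl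

lemma isLpRep_regRep (p : ℝ≥0∞) : IsLpRep p (regRep Γ) := by
  classical
  refine ⟨Submodule.span ℂ (Set.range fun x : Γ => lp.single 2 x (1 : ℂ)), ?_, ?_⟩
  · intro f
    have h := lp.hasSum_single (E := fun _ : Γ => ℂ) (p := 2) (by norm_num) f
    refine mem_closure_of_tendsto h (Filter.Eventually.of_forall fun s => ?_)
    refine Submodule.sum_mem _ fun x _ => ?_
    have h1 : lp.single (E := fun _ : Γ => ℂ) 2 x (f x)
        = f x • lp.single (E := fun _ : Γ => ℂ) 2 x (1 : ℂ) := by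
      rw [← lp.single_smul]; simp
    rw [h1]
    exact Submodule.smul_mem _ _ (Submodule.subset_span ⟨x, rfl⟩)
  · intro ξ hξ η hη
    refine Memℓp.of_exponent_ge (memℓp_zero ?_) (zero_le (a := p))
    induction hξ using Submodule.span_induction with
    | zero => simp
    | add a b _ _ ha hb =>
      refine (ha.union hb).subset fun t ht => ?_
      by_contra hc
      simp only [Set.mem_union, Set.mem_ofPred_eq, not_or, not_not] at hc
      exact ht (by rw [map_add, inner_add_right, hc.1, hc.2, add_zero])
    | smul c a _ ha =>
      refine ha.subset fun t ht => ?_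
      intro hc
      exact ht (by rw [map_smul, inner_smul_right, hc, mul_zero])
    | mem a ha =>
      obtain ⟨y, rfl⟩ := ha
      induction hη using Submodule.span_induction with
      | zero => simp
      | add a b _ _ ha hb =>
        refine (ha.union hb).subset fun t ht => ?_
        by_contra hc
        simp only [Set.mem_union, Set.mem_ofPred_eq, not_or, not_not] at hc
        exact ht (by rw [inner_add_left, hc.1, hc.2, add_zero])
      | smul c a _ ha =>
        refine ha.subset fun t ht => ?_
        intro hc
        exact ht (by rw [inner_smul_left, hc, mul_zero])
      | mem a ha =>
        obtain ⟨x, rfl⟩ := ha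
        refine (Set.finite_singleton (x * y⁻¹)).subset fun t ht => ?_
        by_contra hc
        refine ht ?_
        rw [lp.inner_single_left, regRep_apply, lp.single_apply_ne, inner_zero_right]
        intro h
        exact hc (by simp [← h])

lemma repExtend_regRep_apply (x : MonoidAlgebra ℂ Γ) [DecidableEq Γ] (g : Γ) :
    repExtend (regRep Γ) x (lp.single (E := fun _ : Γ => ℂ) 2 1 (1 : ℂ)) g = x.coeff g := by
  induction x using MonoidAlgebra.induction_linear with
  | zero => simp
  | add a b ha hb => simp [ha, hb]
  | single h c =>
    rw [repExtend_single]
    change c * ((regRep Γ h : lp (fun _ : Γ => ℂ) 2 →L[ℂ] lp (fun _ : Γ => ℂ) 2)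
      (lp.single (E := fun _ : Γ => ℂ) 2 1 (1 : ℂ))) g = _
    rw [regRep_apply]
    by_cases hg : h = g
    · subst hg; simp
    · rw [lp.single_apply_ne]
      · simp [hg]
      · intro h'
        exact hg (by rw [inv_mul_eq_one] at h'; exact h')

lemma eq_zero_of_groupLpNorm {p : ℝ≥0∞} {x : MonoidAlgebra ℂ Γ} (h : groupLpNorm p x = 0) : x = 0 := by
  classical
  have h1 := norm_repExtend_le_groupLpNorm (isLpRep_regRep (Γ := Γ) p) x
  rw [h, norm_le_zero_iff] at h1
  ext g
  rw [← repExtend_regRep_apply x g, h1]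
  simp

end Representations

/-! ### The C*-algebra `C*_{ℓ^p}(Γ)` -/

section CStar

universe u

/-- The norm `groupLpNorm` as a bundled norm on the additive group of `ℂ[Γ]`. -/
def lpAddGroupNorm (p : ℝ≥0∞) (Γ : Type u) [Group Γ] : AddGroupNorm (MonoidAlgebra ℂ Γ) where
  toFun := groupLpNorm p
  map_zero' := le_antisymm
    (groupLpNorm_le le_rfl fun H _ _ _ π _ => by rw [map_zero, norm_zero]) (groupLpNorm_nonneg p _)
  add_le' x y := groupLpNorm_le (add_nonneg (groupLpNorm_nonneg p _) (groupLpNorm_nonneg p _))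
    fun H _ _ _ π hπ => by
      rw [map_add]
      exact (norm_add_le _ _).trans
        (add_le_add (norm_repExtend_le_groupLpNorm hπ x) (norm_repExtend_le_groupLpNorm hπ y))
  neg' x := by simp only [groupLpNorm, lpRepNorms, map_neg, norm_neg]
  eq_zero_of_map_eq_zero' _ hx := eq_zero_of_groupLpNorm hx

/-- The group algebra `ℂ[Γ]`, to be equipped with the norm coming from `ℓ^p`-representations. -/
def LpGroupAlg (_p : ℝ≥0∞) (Γ : Type u) [Group Γ] : Type u := MonoidAlgebra ℂ Γ

variable (p : ℝ≥0∞) (Γ : Type u) [Group Γ]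

instance : Ring (LpGroupAlg p Γ) := inferInstanceAs (Ring (MonoidAlgebra ℂ Γ))

instance : Algebra ℂ (LpGroupAlg p Γ) := inferInstanceAs (Algebra ℂ (MonoidAlgebra ℂ Γ))

/-- The identity map from `ℂ[Γ]` to its normed copy. -/
def toLpGroupAlg : MonoidAlgebra ℂ Γ ≃ₐ[ℂ] LpGroupAlg p Γ := AlgEquiv.refl

instance : StarRing (LpGroupAlg p Γ) where
  star := groupAlgStar (Γ := Γ)
  star_involutive := groupAlgStar_groupAlgStar (Γ := Γ)
  star_mul := groupAlgStar_mul (Γ := Γ)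
  star_add := groupAlgStar_add (Γ := Γ)

instance : StarModule ℂ (LpGroupAlg p Γ) where
  star_smul := groupAlgStar_smul (Γ := Γ)

instance : NormedRing (LpGroupAlg p Γ) where
  __ : Ring (LpGroupAlg p Γ) := inferInstance
  __ : NormedAddCommGroup (LpGroupAlg p Γ) :=
    AddGroupNorm.toNormedAddCommGroup (E := LpGroupAlg p Γ) (lpAddGroupNorm p Γ)
  norm_mul_le x y := groupLpNorm_le (mul_nonneg (groupLpNorm_nonneg p _) (groupLpNorm_nonneg p _))
    fun H _ _ _ π hπ => by
      have h : repExtend π (x * y : MonoidAlgebra ℂ Γ) = repExtend π x * repExtend π y :=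
        map_mul (repExtend π) x y
      exact h ▸ (norm_mul_le _ _).trans
        (mul_le_mul (norm_repExtend_le_groupLpNorm hπ x) (norm_repExtend_le_groupLpNorm hπ y)
          (norm_nonneg _) (groupLpNorm_nonneg p _))

variable {p Γ} in
lemma LpGroupAlg.norm_def (x : LpGroupAlg p Γ) : ‖x‖ = groupLpNorm (Γ := Γ) p x := rfl

instance : NormedAlgebra ℂ (LpGroupAlg p Γ) where
  norm_smul_le c x := groupLpNorm_le (mul_nonneg (norm_nonneg _) (groupLpNorm_nonneg p _))
    fun H _ _ _ π hπ => by
      have h : repExtend π (c • x : MonoidAlgebra ℂ Γ) = c • repExtend π x :=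
        map_smul (repExtend π) c x
      exact h ▸ (norm_smul_le _ _).trans
        (mul_le_mul_of_nonneg_left (norm_repExtend_le_groupLpNorm hπ x) (norm_nonneg _))

instance : CStarRing (LpGroupAlg p Γ) where
  norm_mul_self_le x := by
    have h0 : 0 ≤ ‖star x * x‖ := norm_nonneg _
    rw [← sq, ← Real.le_sqrt (norm_nonneg _) h0]
    refine groupLpNorm_le (Real.sqrt_nonneg _) fun H _ _ _ π hπ => Real.le_sqrt_of_sq_le ?_
    have h' (y : MonoidAlgebra ℂ Γ) :
        repExtend π (groupAlgStar y * y) = star (repExtend π y) * repExtend π y := by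
      rw [map_mul, repExtend_star]
    have h := h' x
    rw [sq, ← CStarRing.norm_star_mul_self, ← h]
    exact norm_repExtend_le_groupLpNorm hπ _

end CStar

/-! The completion of a normed *-algebra whose norm satisfies the C*-identity is a C*-algebra. -/

section Completion

open UniformSpace

variable (A : Type*) [NormedRing A] [StarRing A] [CStarRing A] [NormedAlgebra ℂ A] [StarModule ℂ A]

/-- The involution of the completion is the continuous extension of the given one. -/
@[reducible]
def complStar : Star (Completion A) := ⟨Completion.map star⟩

attribute [local instance] complStar

variable {A} in
lemma complStar_coe (x : A) : ((star x : A) : Completion A) = star (x : Completion A) :=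
  (Completion.map_coe (starₗᵢ ℂ : A ≃ₗᵢ⋆[ℂ] A).isometry.uniformContinuous x).symm

set_option linter.unusedSectionVars false in
lemma continuous_complStar : Continuous (star : Completion A → Completion A) :=
  Completion.continuous_map

/-- The C*-algebra structure on the completion. -/
@[reducible]
def complCStarAlgebra : CStarAlgebra (Completion A) where
  star_involutive x := by
    have hc := continuous_complStar A
    refine Completion.induction_on x (isClosed_eq (hc.comp hc) continuous_id) fun a => ?_
    rw [← complStar_coe, ← complStar_coe, star_star]
  star_mul x y := by
    have hc := continuous_complStar A
    refine Completion.induction_on₂ x y (isClosed_eq (by fun_prop) (by fun_prop)) fun a b => ?_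
    rw [← Completion.coe_mul, ← complStar_coe, ← complStar_coe, ← complStar_coe, star_mul,
      Completion.coe_mul]
  star_add x y := by
    have hc := continuous_complStar A
    refine Completion.induction_on₂ x y (isClosed_eq (by fun_prop) (by fun_prop)) fun a b => ?_
    rw [← Completion.coe_add, ← complStar_coe, ← complStar_coe, ← complStar_coe, star_add,
      Completion.coe_add]
  norm_mul_self_le x := by
    have hc := continuous_complStar A
    refine Completion.induction_on x (isClosed_le (by fun_prop) (by fun_prop)) fun a => ?_
    rw [← complStar_coe, ← Completion.coe_mul, Completion.norm_coe, Completion.norm_coe]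
    exact CStarRing.norm_mul_self_le a
  norm_smul_le := norm_smul_le
  star_smul c x := by
    have hc := continuous_complStar A
    refine Completion.induction_on x
      (isClosed_eq (hc.comp (continuous_const_smul c)) (hc.const_smul (star c))) fun a => ?_
    rw [← Completion.coe_smul, ← complStar_coe, ← complStar_coe, star_smul, Completion.coe_smul]

end Completion

section LpCStar

universe u

open UniformSpace

/-- `C*_{ℓ^p}(Γ)`: the completion of `ℂ[Γ]` in the norm
`‖x‖ = sup {‖π(x)‖ : π is an ℓ^p-representation of Γ}`. -/
def LpCStar (p : ℝ≥0∞) (Γ : Type u) [Group Γ] : Type u := Completion (LpGroupAlg p Γ)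

variable (p : ℝ≥0∞) (Γ : Type u) [Group Γ]

instance : CStarAlgebra (LpCStar p Γ) := complCStarAlgebra (LpGroupAlg p Γ)

/-- The standard order of a C*-algebra; Mathlib's norm on matrices over a C*-algebra asks for it. -/
instance : PartialOrder (LpCStar p Γ) := CStarAlgebra.spectralOrder _

instance : StarOrderedRing (LpCStar p Γ) := CStarAlgebra.spectralOrderedRing _

/-- The canonical embedding of `ℂ[Γ]` in its completion `C*_{ℓ^p}(Γ)`, a *-homomorphism. -/
def toLpCStar : MonoidAlgebra ℂ Γ →ₐ[ℂ] LpCStar p Γ where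
  toFun x := (toLpGroupAlg p Γ x : Completion (LpGroupAlg p Γ))
  map_one' := Completion.coe_one (LpGroupAlg p Γ)
  map_mul' x y := Completion.coe_mul (toLpGroupAlg p Γ x) (toLpGroupAlg p Γ y)
  map_zero' := Completion.coe_zero (α := LpGroupAlg p Γ)
  map_add' x y := Completion.coe_add (toLpGroupAlg p Γ x) (toLpGroupAlg p Γ y)
  commutes' _ := rfl

lemma toLpCStar_star (x : MonoidAlgebra ℂ Γ) :
    toLpCStar p Γ (groupAlgStar x) = star (toLpCStar p Γ x) :=
  complStar_coe (toLpGroupAlg p Γ x)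

lemma norm_toLpCStar (x : MonoidAlgebra ℂ Γ) : ‖toLpCStar p Γ x‖ = groupLpNorm p x :=
  Completion.norm_coe (toLpGroupAlg p Γ x)

lemma denseRange_toLpCStar : DenseRange (toLpCStar p Γ) :=
  Completion.denseRange_coe (α := LpGroupAlg p Γ)

lemma toLpCStar_injective : Function.Injective (toLpCStar p Γ) :=
  Completion.coe_injective (LpGroupAlg p Γ)

end LpCStar

/-! ### Operator spaces -/

section OperatorSpaces

variable {A B : Type*} [CStarAlgebra A] [PartialOrder A] [StarOrderedRing A]
  [CStarAlgebra B] [PartialOrder B] [StarOrderedRing B]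

/-- The norm on `M_n(X)` of an operator space `X`, i.e. a subspace `X` of a C*-algebra `A`: it is
the restriction of the C*-norm of `M_n(A)`. -/
def opSpaceNorm (X : Submodule ℂ A) {n : ℕ} (x : Matrix (Fin n) (Fin n) X) : ℝ :=
  ‖CStarMatrix.ofMatrix (x.map fun a : X => (a : A))‖

/-- The completely bounded norm of a linear map `φ : X → Y` between operator spaces: the supremum
over `n` of the norms of the entrywise maps `M_n(X) → M_n(Y)`, as an element of `[0, ∞]`. -/
def cbNorm {X : Submodule ℂ A} {Y : Submodule ℂ B} (φ : X →ₗ[ℂ] Y) : ℝ≥0∞ :=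
  ⨆ (n : ℕ) (x : Matrix (Fin n) (Fin n) X) (_ : opSpaceNorm X x ≤ 1),
    ENNReal.ofReal (opSpaceNorm Y (x.map φ))

/-- The completely bounded Banach-Mazur distance
`d_cb(X, Y) = inf {‖φ‖_cb ‖φ⁻¹‖_cb : φ : X → Y a linear isomorphism}`. -/
def dcb (X : Submodule ℂ A) (Y : Submodule ℂ B) : ℝ≥0∞ :=
  ⨅ φ : X ≃ₗ[ℂ] Y, cbNorm φ.toLinearMap * cbNorm φ.symm.toLinearMap

end OperatorSpaces

/-! ### The span of the generators of a free group -/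

/-- `𝒲`: the span of `δ_{a_1}, …, δ_{a_d}` in `ℂ[F_d]`, with `a_1, …, a_d` the free generators. -/
def genSpan (d : ℕ) : Submodule ℂ (MonoidAlgebra ℂ (FreeGroup (Fin d))) :=
  Submodule.span ℂ (Set.range fun i : Fin d => MonoidAlgebra.single (FreeGroup.of i) (1 : ℂ))

/-- `𝒲_p`: the copy of `𝒲` in the C*-algebra `C*_{ℓ^p}(F_d)`, an operator space. -/
def genSpanLp (d : ℕ) (p : ℝ≥0∞) : Submodule ℂ (LpCStar p (FreeGroup (Fin d))) :=
  (genSpan d).map (toLpCStar p (FreeGroup (Fin d))).toLinearMap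

/-- The canonical linear isomorphism from `𝒲` to its copy `𝒲_p`. -/
def toGenSpanLp (d : ℕ) (p : ℝ≥0∞) : genSpan d ≃ₗ[ℂ] genSpanLp d p :=
  Submodule.equivMapOfInjective (toLpCStar p (FreeGroup (Fin d))).toLinearMap
    (by exact toLpCStar_injective p (FreeGroup (Fin d))) (genSpan d)

lemma coe_toGenSpanLp (d : ℕ) (p : ℝ≥0∞) (w : genSpan d) :
    (toGenSpanLp d p w : LpCStar p (FreeGroup (Fin d))) = toLpCStar p _ w := rfl

/-- The identity map `T_{p,q} : 𝒲_p → 𝒲_q`, sending the copy of `w ∈ 𝒲` in `C*_{ℓ^p}(F_d)` to its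
copy in `C*_{ℓ^q}(F_d)`. -/
def genSpanId (d : ℕ) (p q : ℝ≥0∞) : genSpanLp d p ≃ₗ[ℂ] genSpanLp d q :=
  (toGenSpanLp d p).symm.trans (toGenSpanLp d q)

lemma genSpanId_toGenSpanLp (d : ℕ) (p q : ℝ≥0∞) (w : genSpan d) :
    genSpanId d p q (toGenSpanLp d p w) = toGenSpanLp d q w := by
  simp [genSpanId]

end

/-!
The estimate holds with `1 / r` in place of `1 + d √(2 (1 - r))`, where
`r = (2d - 1) ^ (1/q - 1/p)`; since `p ≥ 2` forces `r ≥ (2d - 1) ^ (-1/2)`, elementary algebra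
gives `1 / r ≤ 1 + d √(2 (1 - r))` (`inv_le_one_add_mul_sqrt`).

For `0 < t < r` and an `ℓ^q`-representation `π` of the free group on `H`, let `σ` be the
representation with a cyclic vector whose positive definite function is `g ↦ t ^ |g|`. By Hölder's
inequality and the count of reduced words, multiplication by `t ^ |g|` maps `ℓ^q` to `ℓ^p`
(`memℓp_mul_of_norm_le_pow`), so `π ⊗ σ` is an `ℓ^p`-representation (`isLpRep_twistedRep`).
Compressing to `H ⊗ (cyclic vector)` turns `(π ⊗ σ)(a)` into `t π(a)` for every generator `a`. Hence
`t ‖w‖_q ≤ ‖w‖_p` for matrices `w` over the span of the generators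
(`mul_norm_matrix_toLpCStar_le`), and `t` tends to `r`. For the inverse map, an
`ℓ^p`-representation is an `ℓ^q`-representation, and generators are unitaries.

The tensor product is realized on `ℓ²(F; H)` without any GNS construction: the free group is free,
so it suffices to give one unitary for each generator `a`, namely `λ(a) ⊗ π(a)` followed by a
rotation in the coordinates `1` and `a` with sine `t` (`twistedTranslate`). Along reduced words the
orbit of `e₁ ⊗ ξ` is computed letter by letter (`twistedRep_mk_coordIncl_one`): at `g` it is
`v_g ⊗ π(g) ξ`, with `v_g` supported on the path from the root to `g` in the Cayley tree and of
order `t ^ (|g| - |y|)` at `y`.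

The passage from representations to the norm of `M_n(C*_{ℓ^p}(Γ))` rests on the fact that injective
`*`-homomorphisms of C*-algebras are isometric, applied to the map from `M_n(C*_{ℓ^p}(Γ))` to the
product of the algebras `M_n(B(H))` over all `ℓ^p`-representations
(`norm_matrix_toLpCStar_le`).
-/

noncomputable section

/-! ### Matrix norms over `C*_{ℓ^p}(Γ)` -/

section MatrixNorms

universe u

section Lift

variable {Γ : Type u} [Group Γ] {B : Type*} [CStarAlgebra B]

variable (p : ℝ≥0∞) (f : MonoidAlgebra ℂ Γ →ₐ[ℂ] B)

lemma continuous_of_norm_le_groupLpNorm (hf : ∀ x, ‖f x‖ ≤ groupLpNorm p x) :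
    Continuous ((f.comp (toLpGroupAlg p Γ).symm.toAlgHom).toRingHom : LpGroupAlg p Γ →+* B) :=
  AddMonoidHomClass.continuous_of_bound
    ((f.comp (toLpGroupAlg p Γ).symm.toAlgHom).toRingHom : LpGroupAlg p Γ →+* B) 1 fun x => by
      rw [one_mul, LpGroupAlg.norm_def]; exact hf _

/-- The continuous extension to `C*_{ℓ^p}(Γ)` of a homomorphism that is contractive for
`groupLpNorm p`, as a ring homomorphism. -/
def lpCStarLiftRingHom (hf : ∀ x, ‖f x‖ ≤ groupLpNorm p x) : LpCStar p Γ →+* B :=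
  UniformSpace.Completion.extensionHom _ (continuous_of_norm_le_groupLpNorm p f hf)

lemma lpCStarLiftRingHom_toLpCStar (hf : ∀ x, ‖f x‖ ≤ groupLpNorm p x) (x : MonoidAlgebra ℂ Γ) :
    lpCStarLiftRingHom p f hf (toLpCStar p Γ x) = f x :=
  UniformSpace.Completion.extensionHom_coe _ (continuous_of_norm_le_groupLpNorm p f hf)
    (toLpGroupAlg p Γ x)

lemma continuous_lpCStarLiftRingHom (hf : ∀ x, ‖f x‖ ≤ groupLpNorm p x) :
    Continuous (lpCStarLiftRingHom p f hf) :=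
  UniformSpace.Completion.continuous_extension

/-- The universal property of `C*_{ℓ^p}(Γ)`: a `*`-homomorphism from `ℂ[Γ]` to a C*-algebra that is
contractive for `groupLpNorm p` extends to the completion. -/
def lpCStarLift (hstar : ∀ x, f (groupAlgStar x) = star (f x))
    (hf : ∀ x, ‖f x‖ ≤ groupLpNorm p x) : LpCStar p Γ →⋆ₐ[ℂ] B where
  __ := lpCStarLiftRingHom p f hf
  commutes' c := by
    have h := lpCStarLiftRingHom_toLpCStar p f hf (algebraMap ℂ _ c)
    rwa [AlgHom.commutes, AlgHom.commutes] at h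
  map_star' x := by
    have hc := continuous_lpCStarLiftRingHom p f hf
    refine (denseRange_toLpCStar p Γ).induction_on
      (p := fun x => lpCStarLiftRingHom p f hf (star x) = star (lpCStarLiftRingHom p f hf x)) x
      (isClosed_eq (hc.comp continuous_star) (continuous_star.comp hc)) fun a => ?_
    rw [← toLpCStar_star, lpCStarLiftRingHom_toLpCStar, lpCStarLiftRingHom_toLpCStar, hstar]

lemma lpCStarLift_toLpCStar (hstar : ∀ x, f (groupAlgStar x) = star (f x))
    (hf : ∀ x, ‖f x‖ ≤ groupLpNorm p x) (x : MonoidAlgebra ℂ Γ) :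
    lpCStarLift p f hstar hf (toLpCStar p Γ x) = f x :=
  lpCStarLiftRingHom_toLpCStar p f hf x

end Lift

section Entrywise

variable {A B : Type*} [CStarAlgebra A] [PartialOrder A] [StarOrderedRing A]
  [CStarAlgebra B] [PartialOrder B] [StarOrderedRing B] {n : ℕ}

/-- A `*`-homomorphism of C*-algebras is completely contractive. -/
lemma norm_matrix_map_le (φ : A →⋆ₙₐ[ℂ] B) (M : Matrix (Fin n) (Fin n) A) :
    ‖CStarMatrix.ofMatrix (M.map φ)‖ ≤ ‖CStarMatrix.ofMatrix M‖ :=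
  NonUnitalStarAlgHom.norm_apply_le (CStarMatrix.mapₙₐ (n := Fin n) φ) (CStarMatrix.ofMatrix M)

/-- An injective `*`-homomorphism of C*-algebras is completely isometric. -/
lemma norm_matrix_map (φ : A →⋆ₙₐ[ℂ] B) (hφ : Function.Injective φ)
    (M : Matrix (Fin n) (Fin n) A) :
    ‖CStarMatrix.ofMatrix (M.map φ)‖ = ‖CStarMatrix.ofMatrix M‖ := by
  refine NonUnitalStarAlgHom.norm_map (CStarMatrix.mapₙₐ (n := Fin n) φ) (fun M N h => ?_)
    (CStarMatrix.ofMatrix M)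
  ext i j
  exact hφ (congrFun (congrFun h i) j)

end Entrywise

section Compression

open ContinuousLinearMap

variable {H E : Type*} [NormedAddCommGroup H] [InnerProductSpace ℂ H] [CompleteSpace H]
  [NormedAddCommGroup E] [InnerProductSpace ℂ E] [CompleteSpace E]

/-- The embedding `S ↦ V S V*` of `B(H)` as a corner of `B(E)`, for an isometry `V : H → E`. -/
def conjIsometry (V : H →L[ℂ] E) (hV : adjoint V ∘L V = 1) :
    (H →L[ℂ] H) →⋆ₙₐ[ℂ] (E →L[ℂ] E) where
  toFun S := V ∘L S ∘L adjoint V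
  map_smul' c S := by ext; simp
  map_zero' := by ext; simp
  map_add' S T := by ext; simp
  map_mul' S T := by
    have h (x : H) : adjoint V (V x) = x := congrArg (fun T : H →L[ℂ] H => T x) hV
    ext x
    simp [h]
  map_star' S := by
    simp [star_eq_adjoint, adjoint_comp, ContinuousLinearMap.comp_assoc]

/-- Compression of matrices over `B(E)` by an isometry `V : H → E` is contractive: in the corner
`V B(H) V*` it is cutting down by the projection `diag(V V*)`. -/
lemma norm_matrix_compression_le (V : H →L[ℂ] E) (hV : adjoint V ∘L V = 1) {n : ℕ}
    (M : Matrix (Fin n) (Fin n) (E →L[ℂ] E)) :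
    ‖CStarMatrix.ofMatrix (M.map fun T => adjoint V ∘L T ∘L V)‖ ≤ ‖CStarMatrix.ofMatrix M‖ := by
  have h (x : H) : adjoint V (V x) = x := congrArg (fun T : H →L[ℂ] H => T x) hV
  have hinj : Function.Injective (conjIsometry V hV) := by
    intro S T hST
    ext x
    have := congrArg (fun R : E →L[ℂ] E => adjoint V (R (V x))) hST
    simpa [conjIsometry, h] using this
  rw [← norm_matrix_map (conjIsometry V hV) hinj]
  set P : CStarMatrix (Fin n) (Fin n) (E →L[ℂ] E) :=
    CStarMatrix.ofMatrix (Matrix.diagonal fun _ => V ∘L adjoint V)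
  have hproj : IsStarProjection P := by
    constructor
    · refine congrArg CStarMatrix.ofMatrix ((Matrix.diagonal_mul_diagonal _ _).trans ?_)
      congr 1
      ext i x
      simp [h]
    · refine congrArg CStarMatrix.ofMatrix ((Matrix.diagonal_conjTranspose _).trans ?_)
      congr 1
      ext1 i
      simp [star_eq_adjoint, adjoint_comp]
  have hPMP : CStarMatrix.ofMatrix ((M.map fun T => adjoint V ∘L T ∘L V).map (conjIsometry V hV)) =
      P * CStarMatrix.ofMatrix M * P := by
    refine congrArg CStarMatrix.ofMatrix (Eq.trans ?_ (b := (Matrix.diagonal fun _ => V ∘L adjoint V)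
      * M * Matrix.diagonal fun _ => V ∘L adjoint V) rfl)
    ext i j x
    rw [Matrix.mul_diagonal, Matrix.diagonal_mul]
    simp [conjIsometry]
  rw [hPMP]
  have hP1 : ‖P‖ ≤ 1 := IsStarProjection.norm_le P hproj
  calc ‖P * CStarMatrix.ofMatrix M * P‖ ≤ ‖P‖ * ‖CStarMatrix.ofMatrix M‖ * ‖P‖ := norm_mul₃_le
    _ ≤ 1 * ‖CStarMatrix.ofMatrix M‖ * 1 := by gcongr
    _ = _ := by ring

end Compression

section Representations

variable {Γ : Type u} [Group Γ] {p : ℝ≥0∞}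

/-- The `*`-homomorphism `C*_{ℓ^p}(Γ) → B(H)` given by an `ℓ^p`-representation on `H`. -/
def IsLpRep.lift {H : Type u} [NormedAddCommGroup H] [InnerProductSpace ℂ H] [CompleteSpace H]
    {π : Γ →* unitary (H →L[ℂ] H)} (hπ : IsLpRep p π) : LpCStar p Γ →⋆ₐ[ℂ] (H →L[ℂ] H) :=
  lpCStarLift p (repExtend π) (repExtend_star π) (norm_repExtend_le_groupLpNorm hπ)

lemma IsLpRep.lift_toLpCStar {H : Type u} [NormedAddCommGroup H] [InnerProductSpace ℂ H]
    [CompleteSpace H] {π : Γ →* unitary (H →L[ℂ] H)} (hπ : IsLpRep p π) (x : MonoidAlgebra ℂ Γ) :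
    hπ.lift (toLpCStar p Γ x) = repExtend π x :=
  lpCStarLift_toLpCStar p _ _ _ x

/-- An `ℓ^p`-representation is completely contractive for the norm of `C*_{ℓ^p}(Γ)`. -/
lemma norm_matrix_repExtend_le {H : Type u} [NormedAddCommGroup H] [InnerProductSpace ℂ H]
    [CompleteSpace H] {π : Γ →* unitary (H →L[ℂ] H)} (hπ : IsLpRep p π) {n : ℕ}
    (M : Matrix (Fin n) (Fin n) (MonoidAlgebra ℂ Γ)) :
    ‖CStarMatrix.ofMatrix (M.map (repExtend π))‖ ≤
      ‖CStarMatrix.ofMatrix (M.map (toLpCStar p Γ))‖ := by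
  refine le_of_eq_of_le ?_ (norm_matrix_map_le hπ.lift.toNonUnitalStarAlgHom
    (M.map (toLpCStar p Γ)))
  congr 2
  ext1 i j
  exact (hπ.lift_toLpCStar _).symm

variable (Γ p) in
/-- The `ℓ^p`-representations of `Γ`, bundled with the Hilbert spaces they act on; the spaces live in
the universe of `Γ`, as in the definition of `groupLpNorm`. -/
structure LpRep where
  /-- The underlying Hilbert space. -/
  H : Type u
  [normed : NormedAddCommGroup H]
  [inner : InnerProductSpace ℂ H]
  [complete : CompleteSpace H]
  /-- The unitary representation. -/
  π : Γ →* unitary (H →L[ℂ] H)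
  isLpRep : IsLpRep p π

attribute [instance] LpRep.normed LpRep.inner LpRep.complete

/-- The `ℓ^p`-representations separate the points of the completion `C*_{ℓ^p}(Γ)`. -/
lemma eq_zero_of_forall_lift_eq_zero (a : LpCStar p Γ)
    (h : ∀ σ : LpRep Γ p, σ.isLpRep.lift a = 0) : a = 0 := by
  by_contra ha
  have hε : 0 < ‖a‖ / 2 := half_pos (norm_pos_iff.mpr ha)
  obtain ⟨x, hx⟩ := (denseRange_toLpCStar p Γ).exists_dist_lt a hε
  have hle : ‖toLpCStar p Γ x‖ ≤ ‖toLpCStar p Γ x - a‖ := by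
    conv_lhs => rw [norm_toLpCStar]
    refine groupLpNorm_le (norm_nonneg _) fun H _ _ _ π hπ => ?_
    have h1 : repExtend π x = hπ.lift (toLpCStar p Γ x - a) := by
      rw [map_sub, hπ.lift_toLpCStar, h ⟨H, π, hπ⟩, sub_zero]
    rw [h1]
    exact NonUnitalStarAlgHom.norm_apply_le _ _
  rw [dist_eq_norm, ← norm_neg, neg_sub] at hx
  have := norm_sub_norm_le a (toLpCStar p Γ x)
  rw [norm_sub_rev] at this
  linarith

/-- The family of all `ℓ^p`-representations, as a `*`-homomorphism from `M_n(C*_{ℓ^p}(Γ))` to a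
product of C*-algebras. -/
def matrixLpRepHom (p : ℝ≥0∞) (Γ : Type u) [Group Γ] (n : ℕ) :
    CStarMatrix (Fin n) (Fin n) (LpCStar p Γ) →⋆ₙₐ[ℂ]
      lp (fun σ : LpRep Γ p => CStarMatrix (Fin n) (Fin n) (σ.H →L[ℂ] σ.H)) ∞ where
  toFun M := ⟨fun σ => CStarMatrix.mapₙₐ (n := Fin n) σ.isLpRep.lift.toNonUnitalStarAlgHom M,
    memℓp_infty ⟨‖M‖, by
      rintro _ ⟨σ, rfl⟩
      exact NonUnitalStarAlgHom.norm_apply_le _ M⟩⟩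
  map_smul' c M := by ext1; funext σ; exact map_smul _ c M
  map_zero' := by ext1; funext σ; exact map_zero _
  map_add' M N := by ext1; funext σ; exact map_add _ M N
  map_mul' M N := by ext1; funext σ; exact map_mul _ M N
  map_star' M := by ext1; funext σ; exact map_star _ M

lemma matrixLpRepHom_injective (n : ℕ) : Function.Injective (matrixLpRepHom p Γ n) := by
  refine (injective_iff_map_eq_zero _).mpr fun M hM => ?_
  ext i j
  refine eq_zero_of_forall_lift_eq_zero _ fun σ => ?_
  have h1 : CStarMatrix.mapₙₐ (n := Fin n) σ.isLpRep.lift.toNonUnitalStarAlgHom M = 0 :=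
    congrFun (congrArg Subtype.val hM) σ
  exact congrFun (congrFun h1 i) j

/-- The norm of `M_n(C*_{ℓ^p}(Γ))` is the supremum of the norms in the `ℓ^p`-representations. -/
lemma norm_matrix_toLpCStar_le {n : ℕ} (M : Matrix (Fin n) (Fin n) (MonoidAlgebra ℂ Γ)) {C : ℝ}
    (hC : 0 ≤ C)
    (h : ∀ (H : Type u) [NormedAddCommGroup H] [InnerProductSpace ℂ H] [CompleteSpace H]
      (π : Γ →* unitary (H →L[ℂ] H)), IsLpRep p π →
        ‖CStarMatrix.ofMatrix (M.map (repExtend π))‖ ≤ C) :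
    ‖CStarMatrix.ofMatrix (M.map (toLpCStar p Γ))‖ ≤ C := by
  rw [← NonUnitalStarAlgHom.norm_map (matrixLpRepHom p Γ n) (matrixLpRepHom_injective n)]
  refine lp.norm_le_of_forall_le hC fun σ => ?_
  refine le_of_eq_of_le ?_ (h σ.H σ.π σ.isLpRep)
  congr 1
  ext1 i j
  exact σ.isLpRep.lift_toLpCStar _

end Representations

end MatrixNorms

/-! ### Counting reduced words, and multiplication by decaying functions -/

section Decay

variable {α : Type*} [Fintype α] [DecidableEq α]

/-- The reduced words of length `n` that may follow the letter `b` in a reduced word. -/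
def wordsAfter : ℕ → α × Bool → Finset (List (α × Bool))
  | 0, _ => {[]}
  | n + 1, b => (Finset.univ.erase (b.1, !b.2)).biUnion fun c => (wordsAfter n c).image (List.cons c)

lemma mem_wordsAfter (L : List (α × Bool)) (b : α × Bool) (h : FreeGroup.IsReduced (b :: L)) :
    L ∈ wordsAfter L.length b := by
  induction L generalizing b with
  | nil => simp [wordsAfter]
  | cons c L ih =>
    rw [FreeGroup.isReduced_cons_cons] at h
    simp only [List.length_cons, wordsAfter, Finset.mem_biUnion, Finset.mem_image]
    refine ⟨c, ?_, L, ih c h.2, rfl⟩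
    simp only [Finset.mem_erase, Finset.mem_univ, and_true]
    rintro rfl
    simpa using h.1

lemma card_wordsAfter_le (n : ℕ) (b : α × Bool) :
    (wordsAfter n b).card ≤ (2 * Fintype.card α - 1) ^ n := by
  induction n generalizing b with
  | zero => simp [wordsAfter]
  | succ n ih =>
    refine Finset.card_biUnion_le.trans ((Finset.sum_le_card_nsmul _ _ _ fun c _ =>
      Finset.card_image_le.trans (ih c)).trans (le_of_eq ?_))
    rw [Finset.card_erase_of_mem (Finset.mem_univ _), Finset.card_univ, Fintype.card_prod,
      Fintype.card_bool, smul_eq_mul, mul_comm (Fintype.card α), pow_succ']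

/-- A sphere of radius `n` in the free group on `d` letters has at most `2d (2d - 1) ^ n` points. -/
lemma card_filter_norm_le [Nonempty α] (s : Finset (FreeGroup α)) (n : ℕ) :
    (s.filter fun g => g.norm = n).card ≤
      2 * Fintype.card α * (2 * Fintype.card α - 1) ^ n := by
  have h1 : (s.filter fun g => g.norm = n).image FreeGroup.toWord ⊆
      Finset.univ.biUnion fun b : α × Bool => wordsAfter n b := by
    intro L hL
    simp only [Finset.mem_image, Finset.mem_filter] at hL
    obtain ⟨g, ⟨-, rfl⟩, rfl⟩ := hL
    have hg := FreeGroup.isReduced_toWord (x := g)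
    simp only [Finset.mem_biUnion, Finset.mem_univ, true_and]
    -- The first letter of a reduced word may be repeated, so every word follows some letter.
    suffices ∃ b, FreeGroup.IsReduced (b :: g.toWord) from
      this.imp fun b hb => mem_wordsAfter _ b hb
    cases hL : g.toWord with
    | nil => exact ⟨(Classical.arbitrary α, true), FreeGroup.IsReduced.singleton⟩
    | cons c L =>
      rw [hL] at hg
      exact ⟨c, FreeGroup.isReduced_cons_cons.mpr ⟨fun _ => rfl, hg⟩⟩
  rw [← Finset.card_image_of_injective _ FreeGroup.toWord_injective]
  refine (Finset.card_le_card h1).trans (Finset.card_biUnion_le.trans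
    ((Finset.sum_le_card_nsmul _ _ _ fun b _ => card_wordsAfter_le n b).trans (le_of_eq ?_)))
  rw [Finset.card_univ, Fintype.card_prod, Fintype.card_bool, smul_eq_mul,
    mul_comm (Fintype.card α)]

lemma cast_two_mul_card_sub_one (α : Type*) [Fintype α] [Nonempty α] :
    ((2 * Fintype.card α - 1 : ℕ) : ℝ) = 2 * (Fintype.card α : ℝ) - 1 := by
  have : 0 < Fintype.card α := Fintype.card_pos
  rw [Nat.cast_sub (by omega)]
  push_cast
  ring

lemma summable_pow_norm [Nonempty α] {ρ : ℝ} (hρ : 0 ≤ ρ)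
    (hρ1 : (2 * (Fintype.card α : ℝ) - 1) * ρ < 1) :
    Summable fun g : FreeGroup α => ρ ^ g.norm := by
  set D : ℝ := 2 * (Fintype.card α : ℝ) - 1 with hD
  have hD0 : 0 ≤ D := by rw [hD, ← cast_two_mul_card_sub_one]; positivity
  have hgeo : Summable fun n : ℕ => 2 * (Fintype.card α : ℝ) * (D * ρ) ^ n :=
    (summable_geometric_of_lt_one (by positivity) hρ1).mul_left _
  refine summable_of_sum_le (c := ∑' n : ℕ, 2 * (Fintype.card α : ℝ) * (D * ρ) ^ n)
    (fun g => by positivity) fun s => ?_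
  rw [← Finset.sum_fiberwise_of_maps_to (t := s.image FreeGroup.norm)
    (g := FreeGroup.norm) fun g hg => Finset.mem_image_of_mem _ hg]
  refine le_trans (Finset.sum_le_sum fun n _ => ?_)
    (hgeo.sum_le_tsum (s.image FreeGroup.norm) fun n _ => by positivity)
  rw [Finset.sum_congr rfl fun g hg => by rw [(Finset.mem_filter.mp hg).2], Finset.sum_const,
    nsmul_eq_mul, mul_pow, ← mul_assoc]
  have := card_filter_norm_le s n
  have h2 : ((s.filter fun g => g.norm = n).card : ℝ) ≤ 2 * Fintype.card α * D ^ n := by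
    rw [hD, ← cast_two_mul_card_sub_one]
    exact_mod_cast this
  gcongr

/-- If `t < (2d - 1) ^ (-e)`, then `t ^ |g|` is summable to the power `1 / e` over the free group on
`d` letters. -/
lemma summable_pow_norm_rpow [Nonempty α] {t e : ℝ} (ht : 0 ≤ t) (he : 0 < e)
    (hte : t < (2 * (Fintype.card α : ℝ) - 1) ^ (-e)) :
    Summable fun g : FreeGroup α => (t ^ g.norm) ^ e⁻¹ := by
  have hD : (0 : ℝ) < 2 * (Fintype.card α : ℝ) - 1 := by
    have : (1 : ℝ) ≤ Fintype.card α := by exact_mod_cast Fintype.card_pos (α := α)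
    linarith
  have h1 : t ^ e⁻¹ < (2 * (Fintype.card α : ℝ) - 1)⁻¹ := by
    refine (Real.rpow_lt_rpow ht hte (inv_pos.mpr he)).trans_eq ?_
    rw [← Real.rpow_mul hD.le, neg_mul, mul_inv_cancel₀ he.ne', Real.rpow_neg_one]
  refine (summable_pow_norm (α := α) (ρ := t ^ e⁻¹) (by positivity) ?_).congr fun g => ?_
  · rwa [mul_comm, ← lt_div_iff₀ hD, one_div]
  · rw [← Real.rpow_natCast, ← Real.rpow_natCast, ← Real.rpow_mul ht, ← Real.rpow_mul ht, mul_comm]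

/-- Hölder's inequality: multiplication by a function of order `t ^ |g|` takes `ℓ^q` of the free
group on `d` letters to `ℓ^p` if `t < (2d - 1) ^ (1/q - 1/p)`. -/
lemma memℓp_mul_of_norm_le_pow [Nonempty α] {p q : ℝ≥0∞} (hp : p ≠ 0) (hpq : p < q) {t C : ℝ}
    (ht0 : 0 ≤ t)
    (ht : t < (2 * (Fintype.card α : ℝ) - 1) ^ ((q⁻¹).toReal - (p⁻¹).toReal))
    {f h : FreeGroup α → ℂ} (hf : Memℓp f q) (hh : ∀ g, ‖h g‖ ≤ C * t ^ g.norm) :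
    Memℓp (fun g => h g * f g) p := by
  have hC : 0 ≤ C := by simpa using (norm_nonneg _).trans (hh 1)
  have hp' : p ≠ ∞ := hpq.ne_top
  have hP : 0 < p.toReal := ENNReal.toReal_pos hp hp'
  refine memℓp_gen ?_
  suffices Summable fun g : FreeGroup α => (t ^ g.norm) ^ p.toReal * ‖f g‖ ^ p.toReal by
    refine Summable.of_nonneg_of_le (fun g => by positivity) (fun g => ?_)
      (this.mul_left (C ^ p.toReal))
    rw [norm_mul, Real.mul_rpow (norm_nonneg _) (norm_nonneg _), ← mul_assoc,
      ← Real.mul_rpow hC (by positivity)]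
    gcongr
    exact hh g
  rw [ENNReal.toReal_inv, ENNReal.toReal_inv, ← neg_sub p.toReal⁻¹] at ht
  rcases eq_or_ne q ∞ with rfl | hq
  · obtain ⟨B, hB⟩ := hf.bddAbove
    have hs := summable_pow_norm_rpow ht0 (e := p.toReal⁻¹) (inv_pos.mpr hP) (by simpa using ht)
    simp only [inv_inv] at hs
    refine Summable.of_nonneg_of_le (fun g => by positivity) (fun g => ?_)
      (hs.mul_right (B ^ p.toReal))
    gcongr
    exact hB ⟨g, rfl⟩
  · have hPQ : p.toReal < q.toReal := (ENNReal.toReal_lt_toReal hp' hq).mpr hpq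
    set P := p.toReal
    set Q := q.toReal
    have hQ : 0 < Q := hP.trans hPQ
    have hs := summable_pow_norm_rpow ht0 (sub_pos.mpr (inv_strictAnti₀ hP hPQ)) ht
    have hconj : (P * (P⁻¹ - Q⁻¹))⁻¹.HolderConjugate (Q / P) := by
      have h0 : 0 < Q - P := sub_pos.mpr hPQ
      have h1 : (P * (P⁻¹ - Q⁻¹))⁻¹ = Q / (Q - P) := by field_simp
      rw [h1, Real.holderConjugate_iff]
      refine ⟨(one_lt_div h0).mpr (by linarith), ?_⟩
      field_simp
      ring
    refine Real.summable_mul_of_Lp_Lq_of_nonneg hconj (fun g => by positivity)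
      (fun g => by positivity) (hs.congr fun g => ?_)
      ((hf.summable hQ).congr fun g => ?_)
    · rw [← Real.rpow_mul (by positivity)]
      congr 1
      rw [mul_inv, ← mul_assoc, mul_inv_cancel₀ hP.ne', one_mul]
    · rw [← Real.rpow_mul (norm_nonneg _)]
      congr 1
      change Q = _
      field_simp

end Decay

/-! ### Twisting a representation of the free group -/

section Twist

universe u

open ContinuousLinearMap

section Rotation

variable {ι H : Type*} [DecidableEq ι] [NormedAddCommGroup H] [InnerProductSpace ℂ H]

/-- The isometry `H → ℓ²(ι; H)` onto the `i`-th summand. -/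
def coordIncl (H : Type*) [NormedAddCommGroup H] [InnerProductSpace ℂ H] (i : ι) :
    H →L[ℂ] lp (fun _ : ι => H) 2 :=
  lp.singleContinuousLinearMap ℂ (fun _ : ι => H) 2 i

lemma coordIncl_apply_apply (i j : ι) (ξ : H) :
    coordIncl H i ξ j = if j = i then ξ else 0 := by
  rcases eq_or_ne j i with rfl | h
  · simp [coordIncl]
  · simp [coordIncl, h]

lemma inner_coordIncl_left (i : ι) (ξ : H) (f : lp (fun _ : ι => H) 2) :
    inner ℂ (coordIncl H i ξ) f = inner ℂ ξ (f i) := by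
  simp [coordIncl, lp.inner_single_left]

variable [CompleteSpace H]

lemma adjoint_coordIncl_apply (i : ι) (f : lp (fun _ : ι => H) 2) :
    adjoint (coordIncl H i) f = f i := by
  refine ext_inner_left ℂ fun ξ => ?_
  rw [adjoint_inner_right, inner_coordIncl_left]

lemma adjoint_coordIncl_comp_self (i : ι) : adjoint (coordIncl H i) ∘L coordIncl H i = 1 := by
  ext ξ
  simp [adjoint_coordIncl_apply, coordIncl_apply_apply]

/-- The rotation of `ℓ²(ι; H)` with cosine `s` and sine `t` in the coordinates `i` and `j`. -/
def coordRotation (H : Type*) [NormedAddCommGroup H] [InnerProductSpace ℂ H] [CompleteSpace H]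
    (i j : ι) (s t : ℝ) : lp (fun _ : ι => H) 2 →L[ℂ] lp (fun _ : ι => H) 2 :=
  1 + ((s : ℂ) - 1) • (coordIncl H i ∘L adjoint (coordIncl H i) +
      coordIncl H j ∘L adjoint (coordIncl H j)) +
    (t : ℂ) • (coordIncl H i ∘L adjoint (coordIncl H j) -
      coordIncl H j ∘L adjoint (coordIncl H i))

lemma coordRotation_apply (i j k : ι) (hij : i ≠ j) (s t : ℝ) (f : lp (fun _ : ι => H) 2) :
    coordRotation H i j s t f k =
      if k = i then (s : ℂ) • f i + (t : ℂ) • f j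
      else if k = j then (s : ℂ) • f j - (t : ℂ) • f i else f k := by
  have h : coordRotation H i j s t f k = f k + ((s : ℂ) - 1) • (coordIncl H i (f i) k +
      coordIncl H j (f j) k) + (t : ℂ) • (coordIncl H i (f j) k - coordIncl H j (f i) k) := by
    change f k + ((s : ℂ) - 1) • (coordIncl H i (adjoint (coordIncl H i) f) k +
      coordIncl H j (adjoint (coordIncl H j) f) k) + (t : ℂ) •
      (coordIncl H i (adjoint (coordIncl H j) f) k - coordIncl H j (adjoint (coordIncl H i) f) k) = _
    simp only [adjoint_coordIncl_apply]
  rw [h]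
  simp only [coordIncl_apply_apply]
  rcases eq_or_ne k i with rfl | hi
  · simp only [if_true, if_neg hij]
    module
  · rcases eq_or_ne k j with rfl | hj
    · simp only [if_true, if_neg hi]
      module
    · simp only [if_neg hi, if_neg hj]
      module

lemma star_coordRotation (i j : ι) (s t : ℝ) :
    star (coordRotation H i j s t) = coordRotation H i j s (-t) := by
  simp only [coordRotation, star_eq_adjoint, map_add, map_sub, LinearIsometryEquiv.map_smulₛₗ,
    adjoint_comp, adjoint_adjoint, Complex.conj_ofReal, map_one, Complex.ofReal_neg]
  have h1 : adjoint (1 : lp (fun _ : ι => H) 2 →L[ℂ] lp (fun _ : ι => H) 2) = 1 := star_one _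
  rw [h1]
  module

lemma coordRotation_mul_neg (i j : ι) (hij : i ≠ j) {s t : ℝ} (hst : s ^ 2 + t ^ 2 = 1) :
    coordRotation H i j s t * coordRotation H i j s (-t) = 1 := by
  have hst' : (s : ℂ) ^ 2 + (t : ℂ) ^ 2 = 1 := by exact_mod_cast hst
  have hji := hij.symm
  ext f k
  change coordRotation H i j s t (coordRotation H i j s (-t) f) k = f k
  simp only [coordRotation_apply _ _ _ hij, Complex.ofReal_neg]
  rcases eq_or_ne k i with rfl | hi
  · simp only [if_true, if_neg hji]
    calc _ = ((s : ℂ) ^ 2 + (t : ℂ) ^ 2) • f k := by module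
      _ = _ := by rw [hst', one_smul]
  · rcases eq_or_ne k j with rfl | hj
    · simp only [if_true, if_neg hi]
      calc _ = ((s : ℂ) ^ 2 + (t : ℂ) ^ 2) • f k := by module
        _ = _ := by rw [hst', one_smul]
    · simp only [if_neg hi, if_neg hj]

lemma coordRotation_mem_unitary (i j : ι) (hij : i ≠ j) {s t : ℝ} (hst : s ^ 2 + t ^ 2 = 1) :
    coordRotation H i j s t ∈ unitary (lp (fun _ : ι => H) 2 →L[ℂ] lp (fun _ : ι => H) 2) := by
  rw [Unitary.mem_iff, star_coordRotation]
  refine ⟨?_, coordRotation_mul_neg i j hij hst⟩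
  have := coordRotation_mul_neg (H := H) i j hij (s := s) (t := -t) (by simpa using hst)
  rwa [neg_neg] at this

end Rotation

section Translate

variable {Γ H : Type u} [Group Γ] [NormedAddCommGroup H] [InnerProductSpace ℂ H] [CompleteSpace H]
  (π : Γ →* unitary (H →L[ℂ] H))

lemma unitaryRep_inv_apply_apply (g : Γ) (ξ : H) :
    (π g⁻¹ : H →L[ℂ] H) ((π g : H →L[ℂ] H) ξ) = ξ := by
  have h : (π g⁻¹ * π g : unitary (H →L[ℂ] H)) = 1 := by rw [← map_mul, inv_mul_cancel, map_one]
  exact congrArg (fun u : unitary (H →L[ℂ] H) => (u : H →L[ℂ] H) ξ) h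

/-- The operator `λ(g) ⊗ π(g)` on `ℓ²(Γ; H)`: `(f(x))_x ↦ (π(g) f(g⁻¹ x))_x`. -/
def vecTranslate (g : Γ) (f : lp (fun _ : Γ => H) 2) : lp (fun _ : Γ => H) 2 :=
  ⟨fun x => (π g : H →L[ℂ] H) (f (g⁻¹ * x)), memℓp_gen (by
    simp only [Unitary.norm_map]
    exact (Equiv.mulLeft g⁻¹).summable_iff.mpr ((lp.memℓp f).summable (by norm_num)))⟩

lemma vecTranslate_apply (g x : Γ) (f : lp (fun _ : Γ => H) 2) :
    vecTranslate π g f x = (π g : H →L[ℂ] H) (f (g⁻¹ * x)) := rfl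

/-- The operator `λ(g) ⊗ π(g)` on `ℓ²(Γ; H)` as a surjective isometry. -/
def vecIsometry (g : Γ) : lp (fun _ : Γ => H) 2 ≃ₗᵢ[ℂ] lp (fun _ : Γ => H) 2 where
  toFun := vecTranslate π g
  invFun := vecTranslate π g⁻¹
  left_inv f := by
    ext x
    simp only [vecTranslate_apply, inv_inv, inv_mul_cancel_left, unitaryRep_inv_apply_apply]
  right_inv f := by
    ext x
    have := unitaryRep_inv_apply_apply π g⁻¹ (f x)
    rw [inv_inv] at this
    simp only [vecTranslate_apply, inv_inv, mul_inv_cancel_left, this]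
  map_add' f h := by ext x; simp [vecTranslate_apply]
  map_smul' c f := by ext x; simp [vecTranslate_apply]
  norm_map' f := by
    change ‖vecTranslate π g f‖ = ‖f‖
    rw [lp.norm_eq_tsum_rpow (by norm_num), lp.norm_eq_tsum_rpow (by norm_num)]
    simp only [vecTranslate_apply, Unitary.norm_map]
    congr 1
    exact (Equiv.mulLeft g⁻¹).tsum_eq (fun x => ‖f x‖ ^ (2 : ℝ≥0∞).toReal)

end Translate

section Twisted

variable {Γ H : Type u} [Group Γ] [DecidableEq Γ] [NormedAddCommGroup H] [InnerProductSpace ℂ H]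
  [CompleteSpace H] (π : Γ →* unitary (H →L[ℂ] H)) {s t : ℝ} (hst : s ^ 2 + t ^ 2 = 1)

/-- The operator `λ(g) ⊗ π(g)` on `ℓ²(Γ; H)`, followed by a rotation in the coordinates `1` and `g`
with sine `t`; for `g ≠ 1`. -/
def twistedTranslate (g : Γ) (hg : g ≠ 1) :
    unitary (lp (fun _ : Γ => H) 2 →L[ℂ] lp (fun _ : Γ => H) 2) :=
  ⟨coordRotation H 1 g s t, coordRotation_mem_unitary 1 g hg.symm hst⟩ *
    Unitary.linearIsometryEquiv.symm (vecIsometry π g)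

lemma twistedTranslate_apply (g : Γ) (hg : g ≠ 1) (f : lp (fun _ : Γ => H) 2) (x : Γ) :
    (twistedTranslate π hst g hg : lp (fun _ : Γ => H) 2 →L[ℂ] lp (fun _ : Γ => H) 2) f x =
      (π g : H →L[ℂ] H) (if x = 1 then (s : ℂ) • f g⁻¹ + (t : ℂ) • f 1
        else if x = g then (s : ℂ) • f 1 - (t : ℂ) • f g⁻¹ else f (g⁻¹ * x)) := by
  have h : (twistedTranslate π hst g hg : lp (fun _ : Γ => H) 2 →L[ℂ] lp (fun _ : Γ => H) 2) f x =
    coordRotation H 1 g s t (vecTranslate π g f) x := rfl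
  rw [h, coordRotation_apply _ _ _ hg.symm]
  simp only [vecTranslate_apply]
  split_ifs <;> simp

lemma twistedTranslate_inv (g : Γ) (hg : g ≠ 1) :
    (twistedTranslate π hst g hg)⁻¹ = twistedTranslate π hst g⁻¹ (inv_ne_one.mpr hg) := by
  have hst' : (s : ℂ) ^ 2 + (t : ℂ) ^ 2 = 1 := by exact_mod_cast hst
  refine inv_eq_of_mul_eq_one_left ?_
  ext f x
  change (twistedTranslate π hst g⁻¹ (inv_ne_one.mpr hg) : lp (fun _ : Γ => H) 2 →L[ℂ] lp (fun _ : Γ => H) 2)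
    ((twistedTranslate π hst g hg : lp (fun _ : Γ => H) 2 →L[ℂ] lp (fun _ : Γ => H) 2) f) x = f x
  have hcancel (y z : H) (hyz : y = (π g : H →L[ℂ] H) z) : (π g⁻¹ : H →L[ℂ] H) y = z := by
    rw [hyz, unitaryRep_inv_apply_apply]
  rw [twistedTranslate_apply]
  apply hcancel
  simp only [twistedTranslate_apply, inv_inv, ← map_smul, ← map_add, ← map_sub, if_true, if_neg hg]
  rcases eq_or_ne x 1 with rfl | hx
  · simp only [if_true]
    congr 1
    calc _ = ((s : ℂ) ^ 2 + (t : ℂ) ^ 2) • f 1 := by module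
      _ = _ := by rw [hst', one_smul]
  · rcases eq_or_ne x g⁻¹ with rfl | hx'
    · simp only [if_true, if_neg hx]
      congr 1
      calc _ = ((s : ℂ) ^ 2 + (t : ℂ) ^ 2) • f g⁻¹ := by module
        _ = _ := by rw [hst', one_smul]
    · have h1 : g * x ≠ 1 := fun h => hx' (eq_inv_of_mul_eq_one_right h)
      have h2 : g * x ≠ g := fun h => hx (by simpa using h)
      simp only [if_neg hx, if_neg hx', if_neg h1, if_neg h2, inv_mul_cancel_left]

end Twisted

end Twist

/-! ### Matrix coefficients of the twisted representation -/

section TwistedRep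

universe u

open ContinuousLinearMap

lemma inv_mk_singleton {α : Type*} (b : α × Bool) : (FreeGroup.mk [b])⁻¹ = FreeGroup.mk [(b.1, !b.2)] := rfl

lemma mk_cons {α : Type*} (b : α × Bool) (L : List (α × Bool)) :
    FreeGroup.mk (b :: L) = FreeGroup.mk [b] * FreeGroup.mk L := by
  simp [FreeGroup.mul_mk]

section PrefixWeight

variable {α : Type*} [DecidableEq α] {s t : ℝ}

/-- The coordinate at the word `M` of the unit vector attached to the word `L`: in the tree of words
it lives on the path from the root to `L`. -/
def prefixWeight (s t : ℝ) (L M : List (α × Bool)) : ℝ :=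
  if M <+: L then (if M = [] then 1 else s) * t ^ (L.length - M.length) else 0

lemma abs_prefixWeight_le (hs : |s| ≤ 1) (ht : 0 < t) (L M : List (α × Bool)) :
    |prefixWeight s t L M| ≤ t⁻¹ ^ M.length * t ^ L.length := by
  unfold prefixWeight
  split_ifs with h h'
  · subst h'
    simp [abs_of_pos ht]
  · rw [abs_mul, abs_of_pos (pow_pos ht _), pow_sub₀ _ ht.ne' h.length_le, inv_pow,
      mul_comm (t ^ _)]
    exact mul_le_of_le_one_left (by positivity) hs
  · rw [abs_zero]
    positivity

lemma prefixWeight_concat (L M : List (α × Bool)) (b : α × Bool) :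
    prefixWeight s t (L ++ [b]) M - t * prefixWeight s t L M = if M = L ++ [b] then s else 0 := by
  unfold prefixWeight
  simp only [List.prefix_concat_iff]
  rcases eq_or_ne M (L ++ [b]) with rfl | hM
  · have h : ¬ L ++ [b] <+: L := fun h => by simpa using h.length_le
    simp [h]
  · by_cases h : M <+: L
    · have := h.length_le
      rw [if_pos (Or.inr h), if_pos h, if_neg hM, List.length_append, List.length_singleton,
        Nat.sub_add_comm this, pow_succ]
      ring
    · simp [h, hM]

end PrefixWeight

variable {α H : Type u} [DecidableEq α] [NormedAddCommGroup H] [InnerProductSpace ℂ H]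
  [CompleteSpace H] (π : FreeGroup α →* unitary (H →L[ℂ] H)) {s t : ℝ} (hst : s ^ 2 + t ^ 2 = 1)

/-- The representation of the free group on `ℓ²(F; H)` that sends each generator `a` to the
rotated translation `twistedTranslate π hst a`. It is the tensor product of `π` with the
representation of the free group obtained by the GNS construction from `g ↦ t ^ |g|`. -/
def twistedRep : FreeGroup α →*
    unitary (lp (fun _ : FreeGroup α => H) 2 →L[ℂ] lp (fun _ : FreeGroup α => H) 2) :=
  FreeGroup.lift fun a => twistedTranslate π hst (FreeGroup.of a) (FreeGroup.of_ne_one a)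

lemma mk_singleton_ne_one (b : α × Bool) : FreeGroup.mk [b] ≠ 1 := by
  rw [ne_eq, ← FreeGroup.toWord_eq_nil_iff, FreeGroup.toWord_mk, FreeGroup.reduce_singleton]
  simp

lemma twistedRep_mk_singleton (b : α × Bool) :
    twistedRep π hst (FreeGroup.mk [b]) =
      twistedTranslate π hst (FreeGroup.mk [b]) (mk_singleton_ne_one b) := by
  obtain ⟨a, _ | _⟩ := b
  · have h : FreeGroup.mk [(a, false)] = (FreeGroup.of a)⁻¹ := rfl
    simp only [h, map_inv, twistedRep, FreeGroup.lift_apply_of, twistedTranslate_inv]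
  · exact FreeGroup.lift_apply_of

/-- The orbit of the vectors `e₁ ⊗ ξ`. Along a reduced word the translation of a path never
backtracks, so that each letter only extends the path by one edge. -/
lemma twistedRep_mk_coordIncl_one (L : List (α × Bool)) (hL : FreeGroup.IsReduced L) (ξ : H)
    (y : FreeGroup α) :
    (twistedRep π hst (FreeGroup.mk L)).1
        (coordIncl H 1 ξ) y =
      (prefixWeight s t L y.toWord : ℂ) • (π (FreeGroup.mk L) : H →L[ℂ] H) ξ := by
  induction L generalizing y with
  | nil =>
    have h1 : FreeGroup.mk ([] : List (α × Bool)) = 1 := rfl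
    rw [h1, map_one, map_one]
    change coordIncl H 1 ξ y = _ • ξ
    rw [coordIncl_apply_apply]
    by_cases hy : y = 1
    · simp [hy, prefixWeight]
    · simp [hy, prefixWeight]
  | cons b L ih =>
    have hL' : FreeGroup.IsReduced L := hL.infix ⟨[b], [], by simp⟩
    -- Since `b :: L` is reduced, `L` does not begin with the inverse of `b`: the path to `L` avoids
    -- the vertex `b⁻¹` and everything behind it.
    have hno (M : List (α × Bool)) : ¬ (b.1, !b.2) :: M <+: L := by
      rintro ⟨N, rfl⟩
      rw [List.cons_append, FreeGroup.isReduced_cons_cons] at hL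
      simpa using hL.1
    have hno' (M : List (α × Bool)) : prefixWeight s t L ((b.1, !b.2) :: M) = 0 := by
      rw [prefixWeight, if_neg (hno M)]
    rw [mk_cons, map_mul, map_mul, twistedRep_mk_singleton]
    change (twistedTranslate π hst (FreeGroup.mk [b]) (mk_singleton_ne_one b)).1
      ((twistedRep π hst (FreeGroup.mk L)).1
        (coordIncl H 1 ξ)) y = _ • (π (FreeGroup.mk [b]) : H →L[ℂ] H)
          ((π (FreeGroup.mk L) : H →L[ℂ] H) ξ)
    rw [twistedTranslate_apply, ← map_smul]
    congr 1
    simp only [ih hL', inv_mk_singleton, FreeGroup.toWord_one]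
    have hnil : prefixWeight s t L [] = t ^ L.length := by simp [prefixWeight]
    have hinv : (FreeGroup.mk [(b.1, !b.2)]).toWord = [(b.1, !b.2)] := by
      rw [FreeGroup.toWord_mk, FreeGroup.reduce_singleton]
    rw [hinv, hno', hnil]
    rcases eq_or_ne y 1 with rfl | hy1
    · rw [if_pos rfl]
      simp [prefixWeight, pow_succ', mul_smul]
    rw [if_neg hy1]
    rcases eq_or_ne y (FreeGroup.mk [b]) with rfl | hyb
    · rw [if_pos rfl, FreeGroup.toWord_mk, FreeGroup.reduce_singleton]
      simp [prefixWeight, mul_smul]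
    rw [if_neg hyb]
    congr 2
    obtain ⟨M, hM, rfl⟩ : ∃ M, FreeGroup.IsReduced M ∧ FreeGroup.mk M = y :=
      ⟨y.toWord, FreeGroup.isReduced_toWord, FreeGroup.mk_toWord⟩
    rw [FreeGroup.toWord_mk (L₁ := M), hM.reduce_eq]
    cases M with
    | nil => exact absurd rfl hy1
    | cons c N =>
      by_cases hcb : c = b
      · subst hcb
        have hN : N ≠ [] := by rintro rfl; exact hyb rfl
        have hN' : FreeGroup.IsReduced N := hM.infix ⟨[c], [], by simp⟩
        rw [mk_cons c N, ← inv_mk_singleton, inv_mul_cancel_left, FreeGroup.toWord_mk,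
          hN'.reduce_eq]
        simp [prefixWeight, hN]
      · have hred : FreeGroup.IsReduced ((b.1, !b.2) :: c :: N) := by
          rw [FreeGroup.isReduced_cons_cons]
          refine ⟨fun h => ?_, hM⟩
          by_contra h2
          refine hcb (Prod.ext h.symm ?_)
          revert h2
          cases c.2 <;> cases b.2 <;> simp
        rw [← mk_cons, FreeGroup.toWord_mk, hred.reduce_eq, hno', prefixWeight, if_neg]
        rw [List.cons_prefix_cons]
        exact fun h => hcb h.1

/-- The vector `v_x ⊗ ξ`, where `v_x` is the image under `x` of the cyclic vector of the function
`g ↦ t ^ |g|`. -/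
def pathVector (x : FreeGroup α) (ξ : H) : lp (fun _ : FreeGroup α => H) 2 :=
  (twistedRep π hst x).1
    (coordIncl H 1 ((π x⁻¹ : H →L[ℂ] H) ξ))

lemma twistedRep_pathVector_apply (g x y : FreeGroup α) (ξ : H) :
    (twistedRep π hst g).1 (pathVector π hst x ξ) y =
      (prefixWeight s t (g * x).toWord y.toWord : ℂ) • (π g : H →L[ℂ] H) ξ := by
  have h1 : (twistedRep π hst g).1
      (pathVector π hst x ξ) = (twistedRep π hst (g * x)).1
        (coordIncl H 1 ((π x⁻¹ : H →L[ℂ] H) ξ)) := by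
    rw [map_mul]; rfl
  have h2 : (π (g * x) : H →L[ℂ] H) ((π x⁻¹ : H →L[ℂ] H) ξ) = (π g : H →L[ℂ] H) ξ := by
    have : π (g * x) * π x⁻¹ = π g := by rw [← map_mul, mul_inv_cancel_right]
    exact congrArg (fun u : unitary (H →L[ℂ] H) => (u : H →L[ℂ] H) ξ) this
  rw [h1, ← h2]
  have := twistedRep_mk_coordIncl_one π hst (g * x).toWord FreeGroup.isReduced_toWord
    ((π x⁻¹ : H →L[ℂ] H) ξ) y
  rwa [FreeGroup.mk_toWord] at this

lemma pathVector_apply (x y : FreeGroup α) (ξ : H) :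
    pathVector π hst x ξ y = (prefixWeight s t x.toWord y.toWord : ℂ) • ξ := by
  have := twistedRep_pathVector_apply π hst 1 x y ξ
  rw [map_one, map_one, one_mul] at this
  exact this

/-- A coordinate vector is a combination of the path vectors at a vertex and at its parent. -/
lemma exists_smul_coordIncl_eq (x : FreeGroup α) :
    ∃ (x' : FreeGroup α) (c c' : ℂ), ∀ ξ : H, (s : ℂ) • coordIncl H x ξ =
      c • pathVector π hst x ξ + c' • pathVector π hst x' ξ := by
  rcases List.eq_nil_or_concat' x.toWord with h | ⟨L, b, h⟩
  · refine ⟨1, s, 0, fun ξ => ?_⟩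
    obtain rfl := FreeGroup.toWord_eq_nil_iff.mp h
    rw [zero_smul, add_zero, pathVector, inv_one, map_one, map_one]
    rfl
  · refine ⟨FreeGroup.mk L, 1, -t, fun ξ => ?_⟩
    have hL : FreeGroup.IsReduced L :=
      (FreeGroup.isReduced_toWord (x := x)).infix ⟨[], [b], by simp [h]⟩
    ext y
    change (s : ℂ) • coordIncl H x ξ y = (1 : ℂ) • pathVector π hst x ξ y +
      (-t : ℂ) • pathVector π hst (FreeGroup.mk L) ξ y
    rw [pathVector_apply, pathVector_apply, coordIncl_apply_apply, h, FreeGroup.toWord_mk,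
      hL.reduce_eq, one_smul, smul_smul, ← add_smul]
    have h1 := congrArg (fun r : ℝ => (r : ℂ)) (prefixWeight_concat (s := s) (t := t) L y.toWord b)
    simp only [← h, FreeGroup.toWord_inj] at h1
    push_cast at h1
    rw [neg_mul, ← sub_eq_add_neg, ← h, h1]
    split_ifs <;> simp

section Coefficients

variable [Fintype α] [Nonempty α] {p q : ℝ≥0∞}

/-- The matrix coefficients of the twisted representation between path vectors and coordinate
vectors are those of `π`, multiplied by a function of order `t ^ |g|`. -/
lemma memℓp_inner_pathVector (hp : p ≠ 0) (hpq : p < q) (ht0 : 0 < t)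
    (ht : t < (2 * (Fintype.card α : ℝ) - 1) ^ ((q⁻¹).toReal - (p⁻¹).toReal)) {ξ η : H}
    (h : Memℓp (fun g => inner ℂ η ((π g : H →L[ℂ] H) ξ)) q) (x y : FreeGroup α) :
    Memℓp (fun g => inner ℂ (coordIncl H y η)
      ((twistedRep π hst g).1 (pathVector π hst x ξ))) p := by
  have hs : |s| ≤ 1 := by rw [← sq_le_one_iff_abs_le_one]; nlinarith [sq_nonneg t]
  have ht1 : t ≤ 1 := by nlinarith [sq_nonneg s]
  simp only [inner_coordIncl_left, twistedRep_pathVector_apply, inner_smul_right]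
  refine memℓp_mul_of_norm_le_pow (C := t⁻¹ ^ y.norm * t⁻¹ ^ x.norm) hp hpq ht0.le ht h fun g => ?_
  rw [Complex.norm_real, Real.norm_eq_abs]
  refine (abs_prefixWeight_le hs ht0 _ _).trans ?_
  rw [mul_assoc]
  refine mul_le_mul_of_nonneg_left ?_ (by positivity)
  -- The translation by `x` costs at most a factor `t ^ (-|x|)`.
  have hle : g.norm ≤ (g * x).norm + x.norm := by
    have := FreeGroup.norm_mul_le (g * x) x⁻¹
    rwa [mul_inv_cancel_right, FreeGroup.norm_inv_eq] at this
  calc t ^ (g * x).norm = t⁻¹ ^ x.norm * t ^ ((g * x).norm + x.norm) := by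
        rw [pow_add, inv_pow]; field_simp
    _ ≤ t⁻¹ ^ x.norm * t ^ g.norm := by
        gcongr t⁻¹ ^ x.norm * ?_
        exact pow_le_pow_of_le_one ht0.le ht1 hle

lemma memℓp_inner_coordIncl (hp : p ≠ 0) (hpq : p < q) (hs0 : s ≠ 0) (ht0 : 0 < t)
    (ht : t < (2 * (Fintype.card α : ℝ) - 1) ^ ((q⁻¹).toReal - (p⁻¹).toReal)) {ξ η : H}
    (h : Memℓp (fun g => inner ℂ η ((π g : H →L[ℂ] H) ξ)) q) (x y : FreeGroup α) :
    Memℓp (fun g => inner ℂ (coordIncl H y η)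
      ((twistedRep π hst g).1 (coordIncl H x ξ))) p := by
  obtain ⟨x', c, c', hx⟩ := exists_smul_coordIncl_eq (H := H) π hst x
  have h1 := memℓp_inner_pathVector π hst hp hpq ht0 ht h x y
  have h2 := memℓp_inner_pathVector π hst hp hpq ht0 ht h x' y
  have hs0' : (s : ℂ) ≠ 0 := by exact_mod_cast hs0
  have h3 : coordIncl H x ξ = (s : ℂ)⁻¹ • (c • pathVector π hst x ξ + c' • pathVector π hst x' ξ) := by
    rw [← hx, inv_smul_smul₀ hs0']
  simp only [h3, map_smul, map_add, inner_smul_right, inner_add_right]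
  exact ((h1.const_mul c).add (h2.const_mul c')).const_mul _

/-- The twist of an `ℓ^q`-representation is an `ℓ^p`-representation. -/
lemma isLpRep_twistedRep (hp : p ≠ 0) (hpq : p < q) (hs0 : s ≠ 0) (ht0 : 0 < t)
    (ht : t < (2 * (Fintype.card α : ℝ) - 1) ^ ((q⁻¹).toReal - (p⁻¹).toReal))
    (hπ : IsLpRep q π) : IsLpRep p (twistedRep π hst) := by
  obtain ⟨K, hK, hcoef⟩ := hπ
  -- The dense subspace is the algebraic tensor product of the finitely supported vectors with `K`.
  let S : Set (lp (fun _ : FreeGroup α => H) 2) :=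
    {f | ∃ (x : FreeGroup α) (ξ : H), ξ ∈ K ∧ f = coordIncl H x ξ}
  refine ⟨Submodule.span ℂ S, fun f => ?_, fun f hf k hk => ?_⟩
  · have hmem (x : FreeGroup α) (ξ : H) :
        coordIncl H x ξ ∈ (Submodule.span ℂ S).topologicalClosure := by
      refine map_mem_closure (coordIncl H x).continuous (hK ξ) fun ζ hζ => ?_
      exact Submodule.subset_span ⟨x, ζ, hζ, rfl⟩
    have hsum := lp.hasSum_single (E := fun _ : FreeGroup α => H) (p := 2) (by norm_num) f
    exact (Submodule.isClosed_topologicalClosure _).mem_of_tendsto hsum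
      (Filter.Eventually.of_forall fun s => Submodule.sum_mem _ fun x _ => hmem x _)
  · induction hf using Submodule.span_induction with
    | zero => simpa using! zero_memℓp
    | add a b _ _ ha hb => simpa only [map_add, inner_add_right] using! ha.add hb
    | smul c a _ ha => simpa only [map_smul, inner_smul_right] using ha.const_mul c
    | mem a ha =>
      obtain ⟨x, ξ, hξ, rfl⟩ := ha
      induction hk using Submodule.span_induction with
      | zero => simpa using! zero_memℓp
      | add a b _ _ ha hb => simpa only [inner_add_left] using! ha.add hb
      | smul c a _ ha => simpa only [inner_smul_left] using ha.const_mul (starRingEnd ℂ c)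
      | mem b hb =>
        obtain ⟨y, η, hη, rfl⟩ := hb
        exact memℓp_inner_coordIncl π hst hp hpq hs0 ht0 ht (hcoef ξ hξ η hη) x y

end Coefficients

/-- On the generators, the twist compresses to `t π`. -/
lemma compression_twistedRep_of (a : α) :
    adjoint (coordIncl H 1) ∘L
        (twistedRep π hst (FreeGroup.of a)).1 ∘L
          coordIncl H 1 = (t : ℂ) • (π (FreeGroup.of a) : H →L[ℂ] H) := by
  ext ξ
  have h : twistedRep π hst (FreeGroup.of a) =
      twistedTranslate π hst (FreeGroup.of a) (FreeGroup.of_ne_one a) := FreeGroup.lift_apply_of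
  simp only [comp_apply, adjoint_coordIncl_apply, h, twistedTranslate_apply, coordIncl_apply_apply,
    if_true, inv_eq_one, if_neg (FreeGroup.of_ne_one a), smul_zero, zero_add, map_smul, smul_apply]

end TwistedRep

/-! ### Completely bounded norms on the span of the generators -/

section CbNorm

open ContinuousLinearMap

variable {d : ℕ} {p q : ℝ≥0∞}

/-- On the span of the generators, the twist compresses to `t π`. -/
lemma compression_repExtend_twistedRep {H : Type} [NormedAddCommGroup H] [InnerProductSpace ℂ H]
    [CompleteSpace H] (π : FreeGroup (Fin d) →* unitary (H →L[ℂ] H)) {s t : ℝ}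
    (hst : s ^ 2 + t ^ 2 = 1) {w : MonoidAlgebra ℂ (FreeGroup (Fin d))} (hw : w ∈ genSpan d) :
    adjoint (coordIncl H 1) ∘L repExtend (twistedRep π hst) w ∘L coordIncl H 1 =
      (t : ℂ) • repExtend π w := by
  induction hw using Submodule.span_induction with
  | zero => ext ξ; simp
  | add a b _ _ ha hb =>
    rw [map_add, map_add, smul_add, ← ha, ← hb, add_comp, comp_add]
  | smul c a _ ha =>
    rw [map_smul, map_smul, smul_comm, ← ha, smul_comp, comp_smul]
  | mem a ha =>
    obtain ⟨i, rfl⟩ := ha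
    simp only [repExtend_single, one_smul]
    exact compression_twistedRep_of π hst i

lemma one_le_two_mul_sub_one (hd : 2 ≤ d) : (1 : ℝ) ≤ 2 * d - 1 := by
  have : (2 : ℝ) ≤ d := by exact_mod_cast hd
  linarith

/-- Compressing twists of `ℓ^q`-representations, for `t < (2d - 1) ^ (1/q - 1/p)`. -/
lemma mul_norm_matrix_toLpCStar_le (hd : 2 ≤ d) (hp : p ≠ 0) (hpq : p < q) {n : ℕ}
    (M : Matrix (Fin n) (Fin n) (MonoidAlgebra ℂ (FreeGroup (Fin d))))
    (hM : ∀ i j, M i j ∈ genSpan d) {t : ℝ} (ht0 : 0 < t)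
    (ht : t < (2 * (d : ℝ) - 1) ^ ((q⁻¹).toReal - (p⁻¹).toReal)) :
    t * ‖CStarMatrix.ofMatrix (M.map (toLpCStar q (FreeGroup (Fin d))))‖ ≤
      ‖CStarMatrix.ofMatrix (M.map (toLpCStar p (FreeGroup (Fin d))))‖ := by
  have : Nonempty (Fin d) := ⟨⟨0, by omega⟩⟩
  have hle : (q⁻¹).toReal ≤ (p⁻¹).toReal :=
    ENNReal.toReal_mono (ENNReal.inv_ne_top.mpr hp) (ENNReal.inv_le_inv.mpr hpq.le)
  have ht1 : t < 1 := ht.trans_le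
    (Real.rpow_le_one_of_one_le_of_nonpos (one_le_two_mul_sub_one hd) (by linarith))
  rw [← le_div_iff₀' ht0]
  refine norm_matrix_toLpCStar_le M (by positivity) fun H _ _ _ π hπ => ?_
  rw [le_div_iff₀' ht0]
  have ht2 : 0 < 1 - t ^ 2 := by nlinarith
  have hst : √(1 - t ^ 2) ^ 2 + t ^ 2 = 1 := by rw [Real.sq_sqrt ht2.le]; ring
  have hlp : IsLpRep p (twistedRep π hst) :=
    isLpRep_twistedRep π hst hp hpq (Real.sqrt_pos.mpr ht2).ne' ht0 (by simpa using ht) hπ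
  refine le_trans ?_ ((norm_matrix_compression_le (coordIncl H 1) (adjoint_coordIncl_comp_self 1)
    (M.map (repExtend (twistedRep π hst)))).trans (norm_matrix_repExtend_le hlp M))
  refine le_of_eq ?_
  have hnorm : ‖(t : ℂ)‖ = t := by rw [Complex.norm_real, Real.norm_of_nonneg ht0.le]
  refine (congrArg (· * _) hnorm.symm).trans ((norm_smul _ _).symm.trans ?_)
  congr 1
  ext1 i j
  exact (compression_repExtend_twistedRep π hst (hM i j)).symm

/-- The comparison of norms in the limit `t → (2d - 1) ^ (1/q - 1/p)`. -/
lemma rpow_mul_norm_matrix_toLpCStar_le (hd : 2 ≤ d) (hp : p ≠ 0) (hpq : p < q) {n : ℕ}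
    (M : Matrix (Fin n) (Fin n) (MonoidAlgebra ℂ (FreeGroup (Fin d))))
    (hM : ∀ i j, M i j ∈ genSpan d) :
    (2 * (d : ℝ) - 1) ^ ((q⁻¹).toReal - (p⁻¹).toReal) *
        ‖CStarMatrix.ofMatrix (M.map (toLpCStar q (FreeGroup (Fin d))))‖ ≤
      ‖CStarMatrix.ofMatrix (M.map (toLpCStar p (FreeGroup (Fin d))))‖ := by
  have hr : 0 < (2 * (d : ℝ) - 1) ^ ((q⁻¹).toReal - (p⁻¹).toReal) :=
    Real.rpow_pos_of_pos (by linarith [one_le_two_mul_sub_one hd]) _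
  set r := (2 * (d : ℝ) - 1) ^ ((q⁻¹).toReal - (p⁻¹).toReal)
  have hlim : Filter.Tendsto (fun t : ℝ => t) (nhdsWithin r (Set.Iio r)) (nhds r) :=
    nhdsWithin_le_nhds
  refine le_of_tendsto (hlim.mul_const _) ?_
  filter_upwards [Ioo_mem_nhdsLT hr] with t ht
  exact mul_norm_matrix_toLpCStar_le hd hp hpq M hM ht.1 ht.2

/-- For `p ≤ q` every `ℓ^p`-representation is an `ℓ^q`-representation. -/
lemma norm_matrix_toLpCStar_mono {Γ : Type*} [Group Γ] (hpq : p ≤ q) {n : ℕ}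
    (M : Matrix (Fin n) (Fin n) (MonoidAlgebra ℂ Γ)) :
    ‖CStarMatrix.ofMatrix (M.map (toLpCStar p Γ))‖ ≤
      ‖CStarMatrix.ofMatrix (M.map (toLpCStar q Γ))‖ := by
  refine norm_matrix_toLpCStar_le M (norm_nonneg _) fun H _ _ _ π ⟨K, hK, hcoef⟩ => ?_
  exact norm_matrix_repExtend_le
    ⟨K, hK, fun ξ hξ η hη => (hcoef ξ hξ η hη).of_exponent_ge hpq⟩ M

/-- Matrices over `𝒲_p` are the images of matrices over `𝒲`. -/
lemma exists_map_toGenSpanLp_eq {n : ℕ} (x : Matrix (Fin n) (Fin n) (genSpanLp d p)) :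
    ∃ m : Matrix (Fin n) (Fin n) (genSpan d), m.map (toGenSpanLp d p) = x :=
  ⟨x.map (toGenSpanLp d p).symm, by ext i j; simp⟩

lemma opSpaceNorm_map_toGenSpanLp (p : ℝ≥0∞) {n : ℕ} (m : Matrix (Fin n) (Fin n) (genSpan d)) :
    opSpaceNorm (genSpanLp d p) (m.map (toGenSpanLp d p)) =
      ‖CStarMatrix.ofMatrix ((m.map Subtype.val).map (toLpCStar p (FreeGroup (Fin d))))‖ :=
  rfl

lemma map_genSpanId (p q : ℝ≥0∞) {n : ℕ} (m : Matrix (Fin n) (Fin n) (genSpan d)) :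
    (m.map (toGenSpanLp d p)).map (genSpanId d p q).toLinearMap = m.map (toGenSpanLp d q) := by
  ext1 i j
  exact genSpanId_toGenSpanLp d p q (m i j)

/-- The completely bounded norm is at most the reciprocal of `r = (2d - 1) ^ (1/q - 1/p)`. -/
lemma cbNorm_genSpanId_le (hd : 2 ≤ d) (hp : p ≠ 0) (hpq : p < q) :
    cbNorm (genSpanId d p q).toLinearMap ≤
      ENNReal.ofReal ((2 * (d : ℝ) - 1) ^ ((q⁻¹).toReal - (p⁻¹).toReal))⁻¹ := by
  have hr : 0 < (2 * (d : ℝ) - 1) ^ ((q⁻¹).toReal - (p⁻¹).toReal) :=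
    Real.rpow_pos_of_pos (by linarith [one_le_two_mul_sub_one hd]) _
  refine iSup_le fun n => iSup_le fun x => iSup_le fun hx => ENNReal.ofReal_le_ofReal ?_
  obtain ⟨m, rfl⟩ := exists_map_toGenSpanLp_eq x
  rw [map_genSpanId]
  rw [opSpaceNorm_map_toGenSpanLp] at hx ⊢
  rw [← one_div, le_div_iff₀' hr]
  exact (rpow_mul_norm_matrix_toLpCStar_le hd hp hpq _ fun i j => (m i j).2).trans hx

lemma cbNorm_genSpanId_le_one (hpq : p ≤ q) : cbNorm (genSpanId d q p).toLinearMap ≤ 1 := by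
  refine iSup_le fun n => iSup_le fun x => iSup_le fun hx => ?_
  obtain ⟨m, rfl⟩ := exists_map_toGenSpanLp_eq x
  rw [map_genSpanId, ENNReal.ofReal_le_one]
  rw [opSpaceNorm_map_toGenSpanLp] at hx ⊢
  exact (norm_matrix_toLpCStar_mono hpq _).trans hx

lemma norm_toLpCStar_single {Γ : Type*} [Group Γ] (p : ℝ≥0∞) (g : Γ) :
    ‖toLpCStar p Γ (.single g 1)‖ = 1 := by
  have : Nontrivial (LpCStar p Γ) := (toLpCStar_injective p Γ).nontrivial
  refine CStarRing.norm_of_mem_unitary (Unitary.mem_iff.mpr ⟨?_, ?_⟩) <;>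
  · rw [← toLpCStar_star, ← map_mul, groupAlgStar_single, MonoidAlgebra.single_mul_single]
    simp [← MonoidAlgebra.one_def]

/-- The identification of `A` with `M₁(A)` is isometric. -/
lemma norm_matrix_of_const {A : Type*} [CStarAlgebra A] [PartialOrder A] [StarOrderedRing A]
    (a : A) : ‖CStarMatrix.ofMatrix (Matrix.of fun _ _ : Fin 1 => a)‖ = ‖a‖ := by
  let φ : A →⋆ₙₐ[ℂ] CStarMatrix (Fin 1) (Fin 1) A :=
    { toFun a := CStarMatrix.ofMatrix (Matrix.of fun _ _ => a)
      map_smul' _ _ := rfl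
      map_zero' := rfl
      map_add' _ _ := rfl
      map_mul' a b := by
        ext1 i j
        simp [CStarMatrix.mul_apply]
      map_star' _ := rfl }
  have hφ : Function.Injective φ := fun a b h =>
    congrArg (fun M : CStarMatrix (Fin 1) (Fin 1) A => M 0 0) h
  exact NonUnitalStarAlgHom.norm_map φ hφ a

lemma opSpaceNorm_of_toGenSpanLp (p : ℝ≥0∞) (w : genSpan d) :
    opSpaceNorm (genSpanLp d p) ((Matrix.of fun _ _ : Fin 1 => w).map (toGenSpanLp d p)) =
      ‖toLpCStar p (FreeGroup (Fin d)) w‖ := by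
  rw [opSpaceNorm_map_toGenSpanLp, ← norm_matrix_of_const (toLpCStar p (FreeGroup (Fin d)) w)]
  rfl

/-- The generators have norm one in both algebras. -/
lemma one_le_cbNorm_genSpanId (hd : 2 ≤ d) (p q : ℝ≥0∞) :
    1 ≤ cbNorm (genSpanId d p q).toLinearMap := by
  obtain ⟨w, hw⟩ : ∃ w : genSpan d,
      (w : MonoidAlgebra ℂ (FreeGroup (Fin d))) = .single (FreeGroup.of ⟨0, by omega⟩) 1 :=
    ⟨⟨_, Submodule.subset_span ⟨_, rfl⟩⟩, rfl⟩
  have hw (r : ℝ≥0∞) : opSpaceNorm (genSpanLp d r)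
      ((Matrix.of fun _ _ : Fin 1 => w).map (toGenSpanLp d r)) = 1 := by
    rw [opSpaceNorm_of_toGenSpanLp, hw, norm_toLpCStar_single]
  refine le_trans ?_ (le_iSup₂_of_le 1 ((Matrix.of fun _ _ : Fin 1 => w).map (toGenSpanLp d p))
    (le_iSup_of_le (hw p).le le_rfl))
  rw [map_genSpanId, hw, ENNReal.ofReal_one]

lemma inv_le_one_add_mul_sqrt {d r : ℝ} (hd : 1 ≤ d) (hr1 : r ≤ 1)
    (hr : (2 * d - 1) ^ (-(1 / 2) : ℝ) ≤ r) : r⁻¹ ≤ 1 + d * √(2 * (1 - r)) := by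
  have hD : 0 < 2 * d - 1 := by linarith
  have hr0 : 0 < r := (Real.rpow_pos_of_pos hD _).trans_le hr
  have hr2 : 1 ≤ r ^ 2 * (2 * d - 1) := by
    have h := pow_le_pow_left₀ (Real.rpow_pos_of_pos hD _).le hr 2
    rw [← Real.rpow_mul_natCast hD.le] at h
    norm_num [Real.rpow_neg_one] at h
    rwa [inv_le_iff_one_le_mul₀ hD] at h
  have hx : 1 - r ≤ r * d * √(2 * (1 - r)) := by
    rw [← Real.sqrt_sq (by positivity : 0 ≤ r * d), ← Real.sqrt_mul (sq_nonneg _)]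
    refine Real.le_sqrt_of_sq_le ?_
    -- From `r² (2d - 1) ≥ 1` and `2 d² ≥ 2d - 1`.
    have h1 : 1 ≤ 2 * (r * d) ^ 2 := by nlinarith [sq_nonneg (r * (d - 1)), sq_nonneg r]
    nlinarith [mul_nonneg (sub_nonneg.mpr hr1) (sub_nonneg.mpr h1)]
  rw [inv_le_iff_one_le_mul₀ hr0]
  linarith

end CbNorm

end

theorem theorem3p5 (d : ℕ) (hd : 2 ≤ d) (p q : ℝ≥0∞) (hp : 2 ≤ p) (hpq : p < q) :
    cbNorm (genSpanId d p q).toLinearMap ≤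
        ENNReal.ofReal
          (1 + d * √(2 * (1 - (2 * (d : ℝ) - 1) ^ ((q⁻¹).toReal - (p⁻¹).toReal)))) ∧
      cbNorm (genSpanId d p q).symm.toLinearMap = 1 ∧
      dcb (genSpanLp d p) (genSpanLp d q) ≤
        ENNReal.ofReal
          (1 + d * √(2 * (1 - (2 * (d : ℝ) - 1) ^ ((q⁻¹).toReal - (p⁻¹).toReal)))) := by
  have hp0 : p ≠ 0 := (zero_lt_two.trans_le hp).ne'
  have hD := one_le_two_mul_sub_one hd
  have hexp : (q⁻¹).toReal ≤ (p⁻¹).toReal :=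
    ENNReal.toReal_mono (ENNReal.inv_ne_top.mpr hp0) (ENNReal.inv_le_inv.mpr hpq.le)
  have hexp' : -(1 / 2) ≤ (q⁻¹).toReal - (p⁻¹).toReal := by
    have h2 : (p⁻¹).toReal ≤ 1 / 2 := by
      have := ENNReal.toReal_mono (by simp) (ENNReal.inv_le_inv.mpr hp)
      simpa using this
    linarith [ENNReal.toReal_nonneg (a := q⁻¹)]
  have hT := (cbNorm_genSpanId_le hd hp0 hpq).trans (ENNReal.ofReal_le_ofReal
    (inv_le_one_add_mul_sqrt (by linarith) (Real.rpow_le_one_of_one_le_of_nonpos hD (by linarith))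
      (Real.rpow_le_rpow_of_exponent_le hD hexp')))
  have hTinv : cbNorm (genSpanId d p q).symm.toLinearMap = 1 :=
    le_antisymm (cbNorm_genSpanId_le_one hpq.le) (one_le_cbNorm_genSpanId hd q p)
  refine ⟨hT, hTinv, (iInf_le _ (genSpanId d p q)).trans ?_⟩
  rwa [hTinv, mul_one]
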